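/- For real numbers $a<b$, a Banach space $W$ (over $\mathbb R$ or $\mathbb C$), a function $h:[a,b]\to W$ and $\delta>0$ let $$\mathrm{TV}^{\delta}(h,[a,b])=\sup_{n}\ \sup_{a\le t_0<t_1<\dots<t_n\le b}\ \sum_{i=1}^{n}\max\{\|h(t_i)-h(t_{i-1})\|_W-\delta,\,0\}.$$ For $r\ge 1$ let $\mathcal U^{r}([a,b],W)$ be the set of all $h:[a,b]\to W$ with $\sup_{\delta>0}\delta^{r-1}\mathrm{TV}^{\delta}(h,[a,b])<\infty$, and put $$\|h\|_{r\text{-}\mathrm{TV},[a,b]}=\Big(\sup_{\delta>0}\delta^{r-1}\,\mathrm{TV}^{\delta}(h,[a,b])\Big)^{1/r},\qquad \|h\|_{\mathrm{osc},[a,b]}=\sup_{a\le s<t\le b}\|h(s)-h(t)\|_W .$$ Theorem. Let $p>1$ and $q>1$ satisfy $p^{-1}+q^{-1}>1$. There is a constant $D_{p,q}<\infty$, depending on $p$ and $q$ only, such that the following holds. Let $E$ and $V$ be Banach spaces over the same field ($\mathbb R$ or $\mathbb C$), let $L(E,V)$ be the space of continuous linear maps $E\to V$ with the operator norm, let $a<b$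 be real numbers, and let $f\in\mathcal U^{p}([a,b],L(E,V))$ and $g\in\mathcal U^{q}([a,b],E)$ have no common points of discontinuity. Then for every $t\in[a,b]$ the Riemann–Stieltjes integral $I(t)=\int_a^t[f(s)-f(a)]\,\mathrm dg(s)$ exists (as the limit in $V$ of the sums $\sum_{i=1}^n[f(\xi_i)-f(a)]\,[g(t_i)-g(t_{i-1})]$ over $a=t_0<\dots<t_n=t$, $\xi_i\in[t_{i-1},t_i]$, as the mesh $\max_i(t_i-t_{i-1})$ tends to $0$; $I(a)=0$), the function $I$ belongs to $\mathcal U^{q}([a,b],V)$, and $$\|I\|_{q\text{-}\mathrm{TV},[a,b]}\le D_{p,q}\,\|f\|_{p\text{-}\mathrm{TV},[a,b]}^{\,p-p/q}\,\|f\|_{\mathrm{osc},[a,b]}^{\,1+p/q-p}\,\|g\|_{q\text{-}\mathrm{TV},[a,b]} .$$ -/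

import Mathlib

open scoped NNReal ENNReal

/-- The truncated variation `TV^c(f,[a,b])` at level `c ≥ 0`: the supremum over finite families
`a ≤ t₀ ≤ t₁ ≤ ⋯ ≤ tₙ ≤ b` of `∑ max (‖f tᵢ - f tᵢ₋₁‖ - c, 0)`.  As for `eVariationOn`, points may
be repeated; a repeated point contributes `max (0 - c, 0) = 0`, so the supremum is the same as the
one over strictly increasing families. -/
noncomputable def truncVar {W : Type*} [SeminormedAddCommGroup W]
    (f : ℝ → W) (a b : ℝ) (c : ℝ≥0) : ℝ≥0∞ :=
  ⨆ p : ℕ × {t : ℕ → ℝ // Monotone t ∧ ∀ i, t i ∈ Set.Icc a b},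
    ∑ i ∈ Finset.range p.1,
      ENNReal.ofReal (max (‖f (p.2.1 (i + 1)) - f (p.2.1 i)‖ - (c : ℝ)) 0)

/-- `sup_{δ > 0} δ^(p-1) TV^δ(f,[a,b])`, with values in `[0,∞]`. -/
noncomputable def supTV {W : Type*} [SeminormedAddCommGroup W]
    (p : ℝ) (f : ℝ → W) (a b : ℝ) : ℝ≥0∞ :=
  ⨆ (δ : ℝ≥0) (_ : 0 < δ), (δ : ℝ≥0∞) ^ (p - 1) * truncVar f a b δ

/-- The functional `‖f‖_{p-TV,[a,b]} = (sup_{δ > 0} δ^(p-1) TV^δ(f,[a,b]))^(1/p)`. -/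
noncomputable def pTVSeminorm {W : Type*} [SeminormedAddCommGroup W]
    (p : ℝ) (f : ℝ → W) (a b : ℝ) : ℝ≥0∞ :=
  supTV p f a b ^ (1 / p)

/-- Membership in `𝒰^p([a,b], W)`. Only the values of `f` on `[a,b]` matter. -/
def MemU {W : Type*} [SeminormedAddCommGroup W] (p : ℝ) (f : ℝ → W) (a b : ℝ) : Prop :=
  supTV p f a b < ∞

/-- The oscillation `‖f‖_{osc,[a,b]} = sup_{a ≤ s < t ≤ b} ‖f s - f t‖`. -/
noncomputable def oscSeminorm {W : Type*} [SeminormedAddCommGroup W]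
    (f : ℝ → W) (a b : ℝ) : ℝ≥0∞ :=
  ⨆ (s : ℝ) (t : ℝ) (_ : a ≤ s ∧ s < t ∧ t ≤ b), ENNReal.ofReal ‖f s - f t‖

/-- `f` and `g`, as functions on `[a,b]`, have no common point of discontinuity. -/
def NoCommonDiscontinuity {W W' : Type*} [TopologicalSpace W] [TopologicalSpace W']
    (f : ℝ → W) (g : ℝ → W') (a b : ℝ) : Prop :=
  ∀ t ∈ Set.Icc a b,
    ContinuousWithinAt f (Set.Icc a b) t ∨ ContinuousWithinAt g (Set.Icc a b) t

/-- The Riemann–Stieltjes integral `∫_a^b f dg` exists and equals `I`: the sums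
`∑ f(ξᵢ)[g(tᵢ) - g(tᵢ₋₁)]` over tagged partitions `a = t₀ < ⋯ < tₙ = b`, `ξᵢ ∈ [tᵢ₋₁, tᵢ]`, tend to
`I` as the mesh of the partition tends to `0`. When `a = b` the only partition has `n = 0`, so that
`I = 0`. -/
def HasRSIntegral {𝕜 E V : Type*} [RCLike 𝕜] [NormedAddCommGroup E] [NormedSpace 𝕜 E]
    [NormedAddCommGroup V] [NormedSpace 𝕜 V]
    (f : ℝ → E →L[𝕜] V) (g : ℝ → E) (a b : ℝ) (I : V) : Prop :=
  ∀ ε : ℝ, 0 < ε → ∃ η : ℝ, 0 < η ∧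
    ∀ (n : ℕ) (t ξ : ℕ → ℝ), t 0 = a → t n = b →
      (∀ i < n, t i < t (i + 1)) →
      (∀ i < n, ξ i ∈ Set.Icc (t i) (t (i + 1))) →
      (∀ i < n, t (i + 1) - t i < η) →
      ‖∑ i ∈ Finset.range n, f (ξ i) (g (t (i + 1)) - g (t i)) - I‖ < ε

/-! Riemann–Stieltjes sums are controlled on all scales at once. Sampled along a partition, a
function has a greedy approximation at level c: it stays within c of the samples, and its variation
is at most twice the truncated variation at level c/2. Take such approximations Φ_k of f and Γ_k of
g at the levels ω ρ^k and θ σ^k and telescope the sums of (f - Φ_K) d(g - Γ_K) in K. By summation by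
parts where needed, each step costs an error in one function times a variation of the other. For a
fixed partition the remainder vanishes as K → ∞, so `enorm_sum_le_youngGauge` gives a bound by
`youngGauge`, independent of the number of points, as soon as f oscillates by at most ω or g by at
most θ.

The truncated variation of f at level c is at most c^(1-p) `supTV p f`, and likewise for g with q,
so the gauge is dominated by two geometric series with ratios ρ σ^(1-q) and σ ρ^(1-p). Both ratios
can be made less than 1 because (p-1)(q-1) < 1, which is 1/p + 1/q > 1 (`exists_ratios`,
`youngGauge_le`).

Existence: without common discontinuities the alternative on oscillations holds on all short
intervals. The gauge is superadditive in the interval, so local errors add up to at most the gauge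
of [a,b], which is small for suitable ω and θ (`cauchy_rsSums`).

Estimate: normalise f(a) = 0 and let ω bound the oscillation of f. An increment of I is f(s)(g(t) -
g(s)) plus an error governed by the gauge. The first part inherits the truncated variation of g; the
errors have a finite sum, which truncation turns into a q-TV bound. Balancing the gauge in θ
produces the exponents (`gaugeConst_bound`, `supTV_integral_le`). -/

/-! ### Truncated variation: monotonicity, superadditivity and power bounds. -/

section TruncVar

variable {W : Type*} [SeminormedAddCommGroup W] {f : ℝ → W} {a b : ℝ}

theorem ofReal_max_norm_sub (x : W) (c : ℝ≥0) :
    ENNReal.ofReal (max (‖x‖ - (c : ℝ)) 0) = ‖x‖ₑ - c := by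
  rw [← ofReal_norm, ← ENNReal.ofReal_coe_nnreal, ← ENNReal.ofReal_sub _ c.coe_nonneg]
  rcases le_total (‖x‖ - (c : ℝ)) 0 with h | h
  · rw [max_eq_right h, ENNReal.ofReal_zero, ENNReal.ofReal_of_nonpos h]
  · rw [max_eq_left h]

theorem sum_le_truncVar (c : ℝ≥0) (n : ℕ) {x : ℕ → ℝ} (hx : Monotone x)
    (hab : ∀ i, x i ∈ Set.Icc a b) :
    ∑ i ∈ Finset.range n, (‖f (x (i + 1)) - f (x i)‖ₑ - c) ≤ truncVar f a b c := by
  simp_rw [← ofReal_max_norm_sub]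
  exact le_iSup (fun p : ℕ × {t : ℕ → ℝ // Monotone t ∧ ∀ i, t i ∈ Set.Icc a b} =>
    ∑ i ∈ Finset.range p.1,
      ENNReal.ofReal (max (‖f (p.2.1 (i + 1)) - f (p.2.1 i)‖ - (c : ℝ)) 0)) (n, ⟨x, hx, hab⟩)

theorem truncVar_le_iff {c : ℝ≥0} {M : ℝ≥0∞} :
    truncVar f a b c ≤ M ↔ ∀ (n : ℕ) (x : ℕ → ℝ), Monotone x → (∀ i, x i ∈ Set.Icc a b) →
      ∑ i ∈ Finset.range n, (‖f (x (i + 1)) - f (x i)‖ₑ - c) ≤ M := by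
  refine ⟨fun h n x hx hab => (sum_le_truncVar c n hx hab).trans h, fun h => iSup_le ?_⟩
  rintro ⟨n, x, hx, hab⟩
  simp_rw [ofReal_max_norm_sub]
  exact h n x hx hab

theorem truncVar_anti {c d : ℝ≥0} (h : c ≤ d) : truncVar f a b d ≤ truncVar f a b c :=
  truncVar_le_iff.2 fun n _ hx hab =>
    (Finset.sum_le_sum fun _ _ => tsub_le_tsub_left (by exact_mod_cast h) _).trans
      (sum_le_truncVar c n hx hab)

theorem truncVar_mono {a' b' : ℝ} (ha : a ≤ a') (hb : b' ≤ b) (c : ℝ≥0) :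
    truncVar f a' b' c ≤ truncVar f a b c :=
  truncVar_le_iff.2 fun n _ hx hab =>
    sum_le_truncVar c n hx fun i => Set.Icc_subset_Icc ha hb (hab i)

theorem truncVar_add_le {d : ℝ} (hab : a ≤ b) (hbd : b ≤ d) (c : ℝ≥0) :
    truncVar f a b c + truncVar f b d c ≤ truncVar f a d c := by
  have : Nonempty {t : ℕ → ℝ // Monotone t ∧ ∀ i, t i ∈ Set.Icc a b} :=
    ⟨⟨fun _ => a, monotone_const, fun _ => ⟨le_rfl, hab⟩⟩⟩
  have : Nonempty {t : ℕ → ℝ // Monotone t ∧ ∀ i, t i ∈ Set.Icc b d} :=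
    ⟨⟨fun _ => b, monotone_const, fun _ => ⟨le_rfl, hbd⟩⟩⟩
  refine ENNReal.iSup_add_iSup_le ?_
  rintro ⟨n, x, hx, hx'⟩ ⟨m, y, hy, hy'⟩
  simp only [ofReal_max_norm_sub]
  -- Concatenation takes n + 1 + m steps: the extra one, from `x n` to `y 0`, contributes a
  -- nonnegative term and is dropped.
  set z : ℕ → ℝ := fun i => if i ≤ n then x i else y (i - (n + 1)) with hz
  have hzm : Monotone z := by
    intro i j hij
    simp only [hz]
    split_ifs with h1 h2 h2
    · exact hx hij
    · exact (hx' _).2.trans (hy' _).1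
    · omega
    · exact hy (by omega)
  have hzI : ∀ i, z i ∈ Set.Icc a d := by
    intro i
    simp only [hz]
    split_ifs
    · exact ⟨(hx' _).1, (hx' _).2.trans hbd⟩
    · exact ⟨hab.trans (hy' _).1, (hy' _).2⟩
  refine le_trans ?_ (sum_le_truncVar c (n + 1 + m) hzm hzI)
  rw [Finset.sum_range_add, Finset.sum_range_succ]
  refine add_le_add (le_add_right (Finset.sum_le_sum fun i hi => ?_))
    (Finset.sum_le_sum fun i hi => ?_)
  · have : i < n := Finset.mem_range.1 hi
    simp only [hz, if_pos this.le, if_pos (show i + 1 ≤ n from this), le_refl]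
  · have h1 : n + 1 + i - (n + 1) = i := by omega
    have h2 : n + 1 + i + 1 - (n + 1) = i + 1 := by omega
    simp only [hz, if_neg (show ¬ n + 1 + i ≤ n by omega),
      if_neg (show ¬ n + 1 + i + 1 ≤ n by omega), h1, h2, le_refl]

theorem sum_le_of_superadditive {T : ℝ → ℝ → ℝ≥0∞}
    (hT : ∀ s t u, s ≤ t → t ≤ u → T s t + T t u ≤ T s u) {t : ℕ → ℝ} :
    ∀ n : ℕ, (∀ i < n, t i ≤ t (i + 1)) →
      ∑ i ∈ Finset.range n, T (t i) (t (i + 1)) ≤ T (t 0) (t n)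
  | 0, _ => by simp
  | n + 1, ht => by
    have h0 : ∀ m ≤ n, t 0 ≤ t m := by
      intro m
      induction m with
      | zero => intro _; exact le_rfl
      | succ k ih => intro hk; exact (ih (by omega)).trans (ht k (by omega))
    rw [Finset.sum_range_succ]
    exact (add_le_add_left (sum_le_of_superadditive hT n fun i hi => ht i (by omega)) _).trans
      (hT _ _ _ (h0 n le_rfl) (ht n (by omega)))

theorem truncVar_le_supTV (p : ℝ) {c : ℝ≥0} (hc : 0 < c) :
    truncVar f a b c ≤ ((c ^ (1 - p) : ℝ≥0) : ℝ≥0∞) * supTV p f a b := by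
  have h : (c : ℝ≥0∞) ^ (p - 1) * truncVar f a b c ≤ supTV p f a b :=
    le_iSup₂ (f := fun (δ : ℝ≥0) (_ : 0 < δ) => (δ : ℝ≥0∞) ^ (p - 1) * truncVar f a b δ) c hc
  calc truncVar f a b c
      = ((c ^ (1 - p) : ℝ≥0) : ℝ≥0∞) * ((c : ℝ≥0∞) ^ (p - 1) * truncVar f a b c) := by
        rw [← mul_assoc, ← ENNReal.coe_rpow_of_ne_zero hc.ne', ← ENNReal.coe_mul,
          ← NNReal.rpow_add hc.ne', sub_add_sub_cancel, sub_self, NNReal.rpow_zero,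
          ENNReal.coe_one, one_mul]
    _ ≤ _ := by gcongr

theorem supTV_le {p : ℝ} {M : ℝ≥0∞}
    (h : ∀ c : ℝ≥0, 0 < c → truncVar f a b c ≤ ((c ^ (1 - p) : ℝ≥0) : ℝ≥0∞) * M) :
    supTV p f a b ≤ M := by
  refine iSup₂_le fun c hc => ?_
  calc (c : ℝ≥0∞) ^ (p - 1) * truncVar f a b c
      ≤ (c : ℝ≥0∞) ^ (p - 1) * (((c ^ (1 - p) : ℝ≥0) : ℝ≥0∞) * M) := by gcongr; exact h c hc
    _ = M := by
        rw [← mul_assoc, ← ENNReal.coe_rpow_of_ne_zero hc.ne', ← ENNReal.coe_mul,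
          ← NNReal.rpow_add hc.ne', sub_add_sub_cancel, sub_self, NNReal.rpow_zero,
          ENNReal.coe_one, one_mul]

end TruncVar

/-! ### Greedy approximation of a sequence at a given level. -/

section Greedy

variable {W : Type*} [SeminormedAddCommGroup W]

open Classical in
/-- The index of the last value recorded by the greedy approximation of a sequence: a new value is
recorded as soon as it is further than `c` from the last recorded one. -/
noncomputable def greedyIndex (h : ℕ → W) (c : ℝ≥0) : ℕ → ℕ
  | 0 => 0
  | i + 1 => if ‖h (i + 1) - h (greedyIndex h c i)‖ₑ ≤ c then greedyIndex h c i else i + 1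

theorem greedyIndex_le (h : ℕ → W) (c : ℝ≥0) : ∀ i, greedyIndex h c i ≤ i
  | 0 => le_rfl
  | i + 1 => by
    rw [greedyIndex]
    split_ifs
    · exact (greedyIndex_le h c i).trans i.le_succ
    · exact le_rfl

theorem greedyIndex_mono (h : ℕ → W) (c : ℝ≥0) : Monotone (greedyIndex h c) := by
  refine monotone_nat_of_le_succ fun i => ?_
  rw [greedyIndex]
  split_ifs
  · exact le_rfl
  · exact (greedyIndex_le h c i).trans i.le_succ

theorem enorm_sub_greedy_le (h : ℕ → W) (c : ℝ≥0) :
    ∀ i, ‖h i - h (greedyIndex h c i)‖ₑ ≤ c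
  | 0 => by simp [greedyIndex]
  | i + 1 => by
    rw [greedyIndex]
    split_ifs with hi
    · exact hi
    · simp

theorem greedyIndex_eq_zero {h : ℕ → W} {c : ℝ≥0} (hc : ∀ i, ‖h i - h 0‖ₑ ≤ c) :
    ∀ i, greedyIndex h c i = 0
  | 0 => rfl
  | i + 1 => by rw [greedyIndex, greedyIndex_eq_zero hc i, if_pos (hc _)]

/-- A greedy step is either zero or longer than c, and then removing c/2 loses at most half of it.
-/
theorem greedy_step_le (h : ℕ → W) (c : ℝ≥0) (i : ℕ) :
    ‖h (greedyIndex h c (i + 1)) - h (greedyIndex h c i)‖ₑ ≤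
      2 * (‖h (greedyIndex h c (i + 1)) - h (greedyIndex h c i)‖ₑ - (c / 2 : ℝ≥0)) := by
  rw [greedyIndex]
  split_ifs with hi
  · simp [enorm_eq_nnnorm]
  · set y := ‖h (i + 1) - h (greedyIndex h c i)‖ₑ
    have hy : (c : ℝ≥0∞) ≤ y := (not_le.1 hi).le
    have h2 : (2 : ℝ≥0∞) * ((c / 2 : ℝ≥0) : ℝ≥0∞) = c := by
      rw [← ENNReal.coe_ofNat, ← ENNReal.coe_mul, mul_div_cancel₀ _ (two_ne_zero)]
    rw [ENNReal.mul_sub (fun _ _ => ENNReal.ofNat_ne_top), h2, two_mul]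
    rw [ENNReal.le_sub_iff_add_le_left ENNReal.coe_ne_top (hy.trans le_self_add)]
    gcongr

theorem sum_greedy_le {f : ℝ → W} {a b : ℝ} (c : ℝ≥0) (n : ℕ) {x : ℕ → ℝ} (hx : Monotone x)
    (hab : ∀ i, x i ∈ Set.Icc a b) :
    ∑ i ∈ Finset.range n, ‖f (x (greedyIndex (f ∘ x) c (i + 1))) -
      f (x (greedyIndex (f ∘ x) c i))‖ₑ ≤ 2 * truncVar f a b (c / 2) := by
  have h1 := sum_le_truncVar (f := f) (c / 2) n (hx.comp (greedyIndex_mono (f ∘ x) c))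
    fun i => hab _
  refine le_trans ?_ (mul_le_mul_right h1 2)
  rw [Finset.mul_sum]
  exact Finset.sum_le_sum fun i _ => greedy_step_le (f ∘ x) c i

end Greedy

/-! ### Discrete Loève–Young inequality and the gauge. -/

section DiscreteYoung

variable {𝕜 E V : Type*} [RCLike 𝕜] [NormedAddCommGroup E] [NormedSpace 𝕜 E]
  [NormedAddCommGroup V] [NormedSpace 𝕜 V]

/-- The discrete Riemann–Stieltjes sum `∑_{j < n} φ j (γ (j + 1) - γ j)`. -/
def discreteSum (φ : ℕ → E →L[𝕜] V) (γ : ℕ → E) (n : ℕ) : V :=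
  ∑ j ∈ Finset.range n, φ j (γ (j + 1) - γ j)

/-- The variation `∑_{j < n} ‖γ (j + 1) - γ j‖` of a finite sequence. -/
noncomputable def seqVar {W : Type*} [SeminormedAddCommGroup W] (γ : ℕ → W) (n : ℕ) : ℝ≥0∞ :=
  ∑ j ∈ Finset.range n, ‖γ (j + 1) - γ j‖ₑ

theorem seqVar_sub_le {W : Type*} [SeminormedAddCommGroup W] (γ γ' : ℕ → W) (n : ℕ) :
    seqVar (fun j => γ j - γ' j) n ≤ seqVar γ n + seqVar γ' n := by
  unfold seqVar
  rw [← Finset.sum_add_distrib]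
  refine Finset.sum_le_sum fun j _ => ?_
  rw [sub_sub_sub_comm]
  exact enorm_sub_le

theorem enorm_sub_le_seqVar {W : Type*} [NormedAddCommGroup W] (γ : ℕ → W) :
    ∀ n, ‖γ n - γ 0‖ₑ ≤ seqVar γ n
  | 0 => by simp [seqVar, enorm_eq_nnnorm]
  | n + 1 => by
    calc ‖γ (n + 1) - γ 0‖ₑ = ‖(γ n - γ 0) + (γ (n + 1) - γ n)‖ₑ := by congr 1; abel
      _ ≤ ‖γ n - γ 0‖ₑ + ‖γ (n + 1) - γ n‖ₑ := enorm_add_le _ _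
      _ ≤ seqVar γ (n + 1) := by
        rw [seqVar, Finset.sum_range_succ]
        gcongr
        exact enorm_sub_le_seqVar γ n

theorem discreteSum_sub_left (φ φ' : ℕ → E →L[𝕜] V) (γ : ℕ → E) (n : ℕ) :
    discreteSum (fun j => φ j - φ' j) γ n = discreteSum φ γ n - discreteSum φ' γ n := by
  simp [discreteSum, Finset.sum_sub_distrib]

theorem discreteSum_sub_right (φ : ℕ → E →L[𝕜] V) (γ γ' : ℕ → E) (n : ℕ) :
    discreteSum φ (fun j => γ j - γ' j) n = discreteSum φ γ n - discreteSum φ γ' n := by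
  simp only [discreteSum, ← Finset.sum_sub_distrib, ← map_sub, sub_sub_sub_comm]

theorem enorm_discreteSum_le {φ : ℕ → E →L[𝕜] V} {η : ℝ≥0∞} (hφ : ∀ j, ‖φ j‖ₑ ≤ η)
    (γ : ℕ → E) (n : ℕ) : ‖discreteSum φ γ n‖ₑ ≤ η * seqVar γ n := by
  rw [seqVar, Finset.mul_sum]
  refine (enorm_sum_le _ _).trans (Finset.sum_le_sum fun j _ => ?_)
  exact (ContinuousLinearMap.le_opENorm _ _).trans (by gcongr; exact hφ j)

theorem discreteSum_by_parts (φ : ℕ → E →L[𝕜] V) (γ : ℕ → E) :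
    ∀ n, discreteSum φ γ n = φ n (γ n) - φ 0 (γ 0) -
      ∑ j ∈ Finset.range n, (φ (j + 1) - φ j) (γ (j + 1))
  | 0 => by simp [discreteSum]
  | n + 1 => by
    have ih := discreteSum_by_parts φ γ n
    rw [discreteSum] at ih ⊢
    rw [Finset.sum_range_succ, Finset.sum_range_succ, ih, map_sub, sub_apply]
    abel

/-- Summation by parts moves the variation onto φ; the boundary term and the sum each cost θ times
that variation. -/
theorem enorm_discreteSum_le_by_parts {φ : ℕ → E →L[𝕜] V} (h0 : φ 0 = 0) {γ : ℕ → E}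
    {θ : ℝ≥0∞} (hγ : ∀ j, ‖γ j‖ₑ ≤ θ) (n : ℕ) :
    ‖discreteSum φ γ n‖ₑ ≤ 2 * θ * seqVar φ n := by
  rw [discreteSum_by_parts, h0, zero_apply, sub_zero]
  refine enorm_sub_le.trans ?_
  rw [two_mul, add_mul]
  refine add_le_add ?_ ?_
  · have h := enorm_sub_le_seqVar φ n
    rw [h0, sub_zero] at h
    rw [mul_comm θ]
    exact (ContinuousLinearMap.le_opENorm _ _).trans (mul_le_mul' h (hγ n))
  · rw [seqVar, Finset.mul_sum]
    refine (enorm_sum_le _ _).trans (Finset.sum_le_sum fun j _ => ?_)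
    rw [mul_comm θ]
    exact (ContinuousLinearMap.le_opENorm _ _).trans (by gcongr; exact hγ _)

/-- A Loève–Young type bound for discrete sums: `φ` and `γ` are approximated by sequences `Φ k` and
`Γ k` with errors `η k` and `θ k`. -/
theorem enorm_discreteSum_le_telescope {φ : ℕ → E →L[𝕜] V} {γ : ℕ → E}
    {Φ : ℕ → ℕ → E →L[𝕜] V} {Γ : ℕ → ℕ → E} {η θ : ℕ → ℝ≥0∞} (hΦ0 : ∀ k, Φ k 0 = φ 0)
    (hΦ : ∀ k j, ‖φ j - Φ k j‖ₑ ≤ η k) (hΓ : ∀ k j, ‖γ j - Γ k j‖ₑ ≤ θ k)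
    (h0 : (∀ j, ‖φ j - φ 0‖ₑ ≤ η 0) ∨ ∀ j, Γ 0 j = γ 0) (n K : ℕ) :
    ‖discreteSum (fun j => φ j - φ 0) γ n‖ₑ ≤
      η 0 * seqVar (Γ 0) n + 2 * θ 0 * seqVar (Φ 0) n +
      ∑ k ∈ Finset.range K, (η k * (seqVar (Γ (k + 1)) n + seqVar (Γ k) n) +
        2 * θ (k + 1) * (seqVar (Φ (k + 1)) n + seqVar (Φ k) n)) +
      ‖discreteSum (fun j => φ j - Φ K j) (fun j => γ j - Γ K j) n‖ₑ := by
  induction K with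
  | zero =>
    have hsplit : discreteSum (fun j => φ j - φ 0) γ n =
        discreteSum (fun j => φ j - φ 0) (Γ 0) n +
        discreteSum (fun j => Φ 0 j - φ 0) (fun j => γ j - Γ 0 j) n +
        discreteSum (fun j => φ j - Φ 0 j) (fun j => γ j - Γ 0 j) n := by
      simp only [discreteSum_sub_left, discreteSum_sub_right]
      abel
    rw [hsplit, Finset.sum_range_zero, add_zero]
    refine (enorm_add_le _ _).trans (add_le_add_left ((enorm_add_le _ _).trans ?_) _)
    refine add_le_add ?_ ?_
    -- This is the only use of the alternative `h0`: the coarsest term is small if φ oscillates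
    -- little, and vanishes if `Γ 0` is constant.
    · rcases h0 with h | h
      · exact enorm_discreteSum_le h _ _
      · simp [discreteSum, h]
    · refine (enorm_discreteSum_le_by_parts (by rw [hΦ0, sub_self]) (hΓ 0) n).trans ?_
      gcongr
      simp [seqVar]
  | succ K ih =>
    refine ih.trans ?_
    have hsplit : discreteSum (fun j => φ j - Φ K j) (fun j => γ j - Γ K j) n =
        discreteSum (fun j => φ j - Φ K j) (fun j => Γ (K + 1) j - Γ K j) n +
        discreteSum (fun j => Φ (K + 1) j - Φ K j) (fun j => γ j - Γ (K + 1) j) n +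
        discreteSum (fun j => φ j - Φ (K + 1) j) (fun j => γ j - Γ (K + 1) j) n := by
      simp only [discreteSum_sub_left, discreteSum_sub_right]
      abel
    rw [hsplit, Finset.sum_range_succ, ← add_assoc _ (Finset.sum _ _),
      add_assoc _ (_ + _) (enorm (discreteSum _ _ n))]
    refine add_le_add le_rfl ?_
    refine (enorm_add_le _ _).trans (add_le_add_left ((enorm_add_le _ _).trans ?_) _)
    refine add_le_add ?_ ?_
    · exact (enorm_discreteSum_le (hΦ K) _ _).trans (by gcongr; exact seqVar_sub_le _ _ _)
    · exact (enorm_discreteSum_le_by_parts (by rw [hΦ0, hΦ0, sub_self]) (hΓ (K + 1)) n).trans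
        (by gcongr; exact seqVar_sub_le _ _ _)

/-- The functional controlling Riemann–Stieltjes sums on `[s, t]`, built from the truncated
variations at the geometric levels `ω ρ ^ k` of the integrand and `θ σ ^ k` of the integrator. -/
noncomputable def youngGauge {W W' : Type*} [SeminormedAddCommGroup W] [SeminormedAddCommGroup W']
    (ρ σ ω θ : ℝ≥0) (f : ℝ → W) (g : ℝ → W') (s t : ℝ) : ℝ≥0∞ :=
  ∑' k : ℕ, ((ω * ρ ^ k : ℝ≥0) * truncVar g s t (θ * σ ^ (k + 1) / 2) +
    (θ * σ ^ k : ℝ≥0) * truncVar f s t (ω * ρ ^ k / 2))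

theorem youngGauge_mono {W W' : Type*} [SeminormedAddCommGroup W] [SeminormedAddCommGroup W']
    {ρ σ ω θ : ℝ≥0} {f : ℝ → W} {g : ℝ → W'} {a b s t : ℝ} (hs : a ≤ s) (ht : t ≤ b) :
    youngGauge ρ σ ω θ f g s t ≤ youngGauge ρ σ ω θ f g a b :=
  ENNReal.tsum_le_tsum fun k => by gcongr <;> exact truncVar_mono hs ht _

theorem youngGauge_add_le {W W' : Type*} [SeminormedAddCommGroup W] [SeminormedAddCommGroup W']
    {ρ σ ω θ : ℝ≥0} {f : ℝ → W} {g : ℝ → W'} (s t u : ℝ) (hst : s ≤ t) (htu : t ≤ u) :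
    youngGauge ρ σ ω θ f g s t + youngGauge ρ σ ω θ f g t u ≤ youngGauge ρ σ ω θ f g s u := by
  unfold youngGauge
  rw [← ENNReal.tsum_add]
  refine ENNReal.tsum_le_tsum fun k => ?_
  rw [add_add_add_comm, ← mul_add, ← mul_add]
  gcongr <;> exact truncVar_add_le hst htu _

/-- The points x and y need not interlace, so one bound serves both for moving a tag and for
refining a partition. -/
theorem enorm_sum_le_youngGauge {f : ℝ → E →L[𝕜] V} {g : ℝ → E} {s t : ℝ} {ρ σ ω θ : ℝ≥0}
    (hρ : ρ < 1) (hσ : σ < 1)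
    (h : (∀ x ∈ Set.Icc s t, ∀ y ∈ Set.Icc s t, ‖f x - f y‖ₑ ≤ ω) ∨
      ∀ x ∈ Set.Icc s t, ∀ y ∈ Set.Icc s t, ‖g x - g y‖ₑ ≤ θ)
    {x y : ℕ → ℝ} (hx : Monotone x) (hy : Monotone y) (hxI : ∀ i, x i ∈ Set.Icc s t)
    (hyI : ∀ i, y i ∈ Set.Icc s t) (n : ℕ) :
    ‖∑ j ∈ Finset.range n, (f (x j) - f (x 0)) (g (y (j + 1)) - g (y j))‖ₑ ≤
      8 * youngGauge ρ σ ω θ f g s t := by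
  set Φ : ℕ → ℕ → E →L[𝕜] V := fun k j => f (x (greedyIndex (f ∘ x) (ω * ρ ^ k) j)) with hΦ
  set Γ : ℕ → ℕ → E := fun k j => g (y (greedyIndex (g ∘ y) (θ * σ ^ k) j)) with hΓ
  have hVΦ : ∀ k, seqVar (Φ k) n ≤ 2 * truncVar f s t (ω * ρ ^ k / 2) :=
    fun k => sum_greedy_le _ n hx hxI
  -- The level is lowered from k to k + 1 so that `Γ k` and `Γ (k + 1)`, both paired with ω ρ^k,
  -- share one term of the gauge.
  have hVΓ : ∀ k, seqVar (Γ k) n ≤ 2 * truncVar g s t (θ * σ ^ (k + 1) / 2) := fun k =>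
    (sum_greedy_le _ n hy hyI).trans (by
      gcongr
      refine truncVar_anti ?_
      gcongr θ * ?_ / 2
      exact pow_le_pow_of_le_one zero_le hσ.le k.le_succ)
  have hVΓ' : ∀ k, seqVar (Γ (k + 1)) n ≤ 2 * truncVar g s t (θ * σ ^ (k + 1) / 2) :=
    fun k => sum_greedy_le _ n hy hyI
  have hΦe : ∀ k j, ‖f (x j) - Φ k j‖ₑ ≤ ((ω * ρ ^ k : ℝ≥0) : ℝ≥0∞) :=
    fun k j => enorm_sub_greedy_le (f ∘ x) _ j
  have hΓe : ∀ k j, ‖g (y j) - Γ k j‖ₑ ≤ ((θ * σ ^ k : ℝ≥0) : ℝ≥0∞) :=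
    fun k j => enorm_sub_greedy_le (g ∘ y) _ j
  have key := enorm_discreteSum_le_telescope (φ := fun j => f (x j)) (γ := fun j => g (y j))
    (Φ := Φ) (Γ := Γ) (η := fun k => ((ω * ρ ^ k : ℝ≥0) : ℝ≥0∞))
    (θ := fun k => ((θ * σ ^ k : ℝ≥0) : ℝ≥0∞)) (fun k => rfl) hΦe hΓe
    (by
      refine h.imp (fun h j => ?_) fun h j => ?_
      · simpa using h _ (hxI j) _ (hxI 0)
      · simp only [hΓ]
        rw [greedyIndex_eq_zero fun i => by simpa using h _ (hyI i) _ (hyI 0)]) n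
  -- the remainder is at most `n` terms, each a product of two small factors
  have hrem : ∀ K, ‖discreteSum (fun j => f (x j) - Φ K j) (fun j => g (y j) - Γ K j) n‖ₑ ≤
      ((2 * n * ω * θ * (ρ * σ) ^ K : ℝ≥0) : ℝ≥0∞) := by
    intro K
    refine (enorm_discreteSum_le (hΦe K) _ n).trans ?_
    have : seqVar (fun j => g (y j) - Γ K j) n ≤
        ∑ j ∈ Finset.range n, (2 * (θ * σ ^ K : ℝ≥0) : ℝ≥0∞) :=
      Finset.sum_le_sum fun j _ => enorm_sub_le.trans (by
        rw [two_mul]; exact add_le_add (hΓe K _) (hΓe K _))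
    refine (mul_le_mul_right this _).trans (le_of_eq ?_)
    rw [Finset.sum_const, Finset.card_range, nsmul_eq_mul]
    push_cast
    ring
  have hlim : Filter.Tendsto (fun K => ((2 * n * ω * θ * (ρ * σ) ^ K : ℝ≥0) : ℝ≥0∞))
      Filter.atTop (nhds 0) := by
    rw [← ENNReal.coe_zero, ENNReal.tendsto_coe]
    have := (NNReal.tendsto_pow_atTop_nhds_zero_of_lt_one
      (mul_lt_one_of_nonneg_of_lt_one_left zero_le hρ hσ.le)).const_mul (2 * n * ω * θ)
    rwa [mul_zero] at this
  set S := youngGauge ρ σ ω θ f g s t with hS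
  set u : ℕ → ℝ≥0∞ := fun k => (ω * ρ ^ k : ℝ≥0) * truncVar g s t (θ * σ ^ (k + 1) / 2) with hu
  set v : ℕ → ℝ≥0∞ := fun k => (θ * σ ^ k : ℝ≥0) * truncVar f s t (ω * ρ ^ k / 2) with hv
  have hSuv : S = ∑' k, u k + ∑' k, v k := ENNReal.tsum_add
  have hterm : ∀ k, ((ω * ρ ^ k : ℝ≥0) : ℝ≥0∞) * (seqVar (Γ (k + 1)) n + seqVar (Γ k) n) +
        2 * ((θ * σ ^ (k + 1) : ℝ≥0) : ℝ≥0∞) * (seqVar (Φ (k + 1)) n + seqVar (Φ k) n) ≤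
      4 * u k + (4 * v (k + 1) + 4 * v k) := by
    intro k
    refine add_le_add ?_ ?_
    · calc _ ≤ ((ω * ρ ^ k : ℝ≥0) : ℝ≥0∞) * (2 * truncVar g s t (θ * σ ^ (k + 1) / 2) +
            2 * truncVar g s t (θ * σ ^ (k + 1) / 2)) := by
            gcongr
            · exact hVΓ' k
            · exact hVΓ k
        _ = 4 * u k := by simp only [hu]; ring
    · have h1 : ((θ * σ ^ (k + 1) : ℝ≥0) : ℝ≥0∞) ≤ ((θ * σ ^ k : ℝ≥0) : ℝ≥0∞) := by
        rw [ENNReal.coe_le_coe]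
        gcongr θ * ?_
        exact pow_le_pow_of_le_one zero_le hσ.le k.le_succ
      calc _ ≤ 2 * ((θ * σ ^ (k + 1) : ℝ≥0) : ℝ≥0∞) *
              (2 * truncVar f s t (ω * ρ ^ (k + 1) / 2)) +
            2 * ((θ * σ ^ k : ℝ≥0) : ℝ≥0∞) * (2 * truncVar f s t (ω * ρ ^ k / 2)) := by
            rw [mul_add]
            gcongr
            · exact hVΦ (k + 1)
            · exact hVΦ k
        _ = 4 * v (k + 1) + 4 * v k := by simp only [hv]; ring
  have hfirst : ((ω * ρ ^ 0 : ℝ≥0) : ℝ≥0∞) * seqVar (Γ 0) n ≤ 2 * u 0 := by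
    calc _ ≤ ((ω * ρ ^ 0 : ℝ≥0) : ℝ≥0∞) * (2 * truncVar g s t (θ * σ ^ (0 + 1) / 2)) := by
          gcongr; exact hVΓ 0
      _ = 2 * u 0 := by simp only [hu]; ring
  have hsecond : 2 * ((θ * σ ^ 0 : ℝ≥0) : ℝ≥0∞) * seqVar (Φ 0) n ≤ 4 * v 0 := by
    calc _ ≤ 2 * ((θ * σ ^ 0 : ℝ≥0) : ℝ≥0∞) * (2 * truncVar f s t (ω * ρ ^ 0 / 2)) := by
          gcongr; exact hVΦ 0
      _ = 4 * v 0 := by simp only [hv]; ring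
  have hmain : ∀ K, ‖discreteSum (fun j => f (x j) - f (x 0)) (fun j => g (y j)) n‖ₑ ≤
      8 * S + ((2 * n * ω * θ * (ρ * σ) ^ K : ℝ≥0) : ℝ≥0∞) := by
    intro K
    refine (key K).trans (add_le_add ?_ (hrem K))
    calc _ ≤ 2 * u 0 + 4 * v 0 + ∑ k ∈ Finset.range K, (4 * u k + (4 * v (k + 1) + 4 * v k)) :=
          add_le_add (add_le_add hfirst hsecond) (Finset.sum_le_sum fun k _ => hterm k)
      _ = 2 * u 0 + 4 * ∑ k ∈ Finset.range K, u k + 4 * ∑ k ∈ Finset.range (K + 1), v k +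
            4 * ∑ k ∈ Finset.range K, v k := by
          rw [Finset.sum_range_succ' v]
          simp only [Finset.sum_add_distrib, ← Finset.mul_sum]
          ring
      _ ≤ 2 * ∑' k, u k + 4 * ∑' k, u k + 4 * ∑' k, v k + 4 * ∑' k, v k := by
          gcongr <;> first | exact ENNReal.sum_le_tsum _ | exact ENNReal.le_tsum _
      _ = 6 * ∑' k, u k + 8 * ∑' k, v k := by ring
      _ ≤ 8 * S := by
          rw [hSuv, mul_add]
          gcongr
          norm_num
  have := ge_of_tendsto' (tendsto_const_nhds.add hlim) hmain
  rwa [add_zero] at this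

theorem enorm_apply_le_youngGauge {f : ℝ → E →L[𝕜] V} {g : ℝ → E} {s t : ℝ} {ρ σ ω θ : ℝ≥0}
    (hρ : ρ < 1) (hσ : σ < 1)
    (h : (∀ x ∈ Set.Icc s t, ∀ y ∈ Set.Icc s t, ‖f x - f y‖ₑ ≤ ω) ∨
      ∀ x ∈ Set.Icc s t, ∀ y ∈ Set.Icc s t, ‖g x - g y‖ₑ ≤ θ) {ξ : ℝ} (hξ : ξ ∈ Set.Icc s t) :
    ‖(f ξ - f s) (g t - g s)‖ₑ ≤ 8 * youngGauge ρ σ ω θ f g s t := by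
  have hst := hξ.1.trans hξ.2
  -- Two steps: x runs s, ξ while y runs s, s, t, so the first term is zero and the second is the
  -- required product.
  have := enorm_sum_le_youngGauge hρ hσ h (x := fun j => if j = 0 then s else ξ)
    (y := fun j => if j ≤ 1 then s else t)
    (monotone_nat_of_le_succ fun n => by
      by_cases hn : n = 0 <;> simp [hn, hξ.1])
    (monotone_nat_of_le_succ fun n => by
      by_cases hn : n = 0
      · simp [hn]
      · simp only [show ¬ n + 1 ≤ 1 by omega, if_false]
        split_ifs
        exacts [hst, le_rfl])
    (fun i => by split_ifs; exacts [⟨le_rfl, hst⟩, hξ])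
    (fun i => by split_ifs; exacts [⟨le_rfl, hst⟩, ⟨hst, le_rfl⟩]) 2
  simpa [Finset.sum_range_succ] using this

theorem enorm_block_le_youngGauge {f : ℝ → E →L[𝕜] V} {g : ℝ → E} {ρ σ ω θ : ℝ≥0}
    (hρ : ρ < 1) (hσ : σ < 1) {u : ℕ → ℝ} (hu : Monotone u) {i j : ℕ} (hij : i ≤ j)
    (h : (∀ x ∈ Set.Icc (u i) (u j), ∀ y ∈ Set.Icc (u i) (u j), ‖f x - f y‖ₑ ≤ ω) ∨
      ∀ x ∈ Set.Icc (u i) (u j), ∀ y ∈ Set.Icc (u i) (u j), ‖g x - g y‖ₑ ≤ θ) :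
    ‖∑ k ∈ Finset.Ico i j, f (u k) (g (u (k + 1)) - g (u k)) - f (u i) (g (u j) - g (u i))‖ₑ ≤
      8 * youngGauge ρ σ ω θ f g (u i) (u j) := by
  -- The sequence is stopped at j so that all its values stay in the block.
  have hm : Monotone fun k => u (min (i + k) j) := fun k l hkl => hu (by omega)
  have hI : ∀ k, u (min (i + k) j) ∈ Set.Icc (u i) (u j) := fun k => ⟨hu (by omega), hu (by omega)⟩
  have key := enorm_sum_le_youngGauge hρ hσ h hm hm hI hI (j - i)
  convert key using 2
  rw [← Finset.sum_Ico_sub (fun k => g (u k)) hij, map_sum, ← Finset.sum_sub_distrib,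
    Finset.sum_Ico_eq_sum_range]
  refine Finset.sum_congr rfl fun k hk => ?_
  have hk' : i + k < j := by have := Finset.mem_range.1 hk; omega
  rw [min_eq_left hk'.le, add_zero, min_eq_left hij, ← add_assoc, min_eq_left hk',
    sub_apply]

end DiscreteYoung

/-! ### Partitions through given points, and local smallness of oscillations. -/

section Partitions

theorem exists_partition_of_finset {S : Finset ℝ} {a b : ℝ} (ha : a ∈ S) (hb : b ∈ S)
    (hS : ∀ x ∈ S, x ∈ Set.Icc a b) :
    ∃ (m : ℕ) (u : ℕ → ℝ), Monotone u ∧ (∀ i < m, u i < u (i + 1)) ∧ u 0 = a ∧ u m = b ∧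
      ∀ x ∈ S, ∃ j ≤ m, u j = x := by
  obtain ⟨m, hm⟩ : ∃ m, S.card = m + 1 :=
    Nat.exists_eq_add_one_of_ne_zero (Finset.card_ne_zero_of_mem ha)
  set e := S.orderEmbOfFin hm with he
  have hmem : ∀ i, e i ∈ Set.Icc a b := fun i => hS _ (S.orderEmbOfFin_mem hm i)
  have hsurj : ∀ x ∈ S, ∃ i, e i = x := by
    intro x hx
    have : x ∈ Set.range e := by rw [he, Finset.range_orderEmbOfFin]; exact hx
    exact this
  set u : ℕ → ℝ := fun j => e ⟨min j m, by omega⟩ with hu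
  have hex : ∀ x ∈ S, ∃ j ≤ m, u j = x := by
    intro x hx
    obtain ⟨i, hi⟩ := hsurj x hx
    refine ⟨i, by omega, ?_⟩
    rw [← hi, hu]
    exact congrArg e (Fin.ext (min_eq_left (by omega)))
  have hmono : Monotone u := fun i j hij => e.monotone (by
    rw [Fin.le_def]
    exact min_le_min_right m hij)
  refine ⟨m, u, hmono, fun i hi => e.strictMono ?_, ?_, ?_, hex⟩
  · rw [Fin.lt_def]
    change min i m < min (i + 1) m
    omega
  · obtain ⟨j, -, hj⟩ := hex a ha
    exact le_antisymm (hj ▸ hmono j.zero_le) (hmem _).1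
  · obtain ⟨j, hjm, hj⟩ := hex b hb
    exact le_antisymm (hmem _).2 (hj ▸ hmono hjm)

theorem exists_fine_partition {S : Finset ℝ} {a b η : ℝ} (ha : a ∈ S) (hb : b ∈ S)
    (hS : ∀ x ∈ S, x ∈ Set.Icc a b) (hη : 0 < η) :
    ∃ (m : ℕ) (u : ℕ → ℝ), Monotone u ∧ (∀ i < m, u i < u (i + 1)) ∧ u 0 = a ∧ u m = b ∧
      (∀ x ∈ S, ∃ j ≤ m, u j = x) ∧ ∀ i < m, u (i + 1) - u i < η := by
  classical
  have hη2 : 0 < η / 2 := half_pos hη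
  set N := ⌊(b - a) / (η / 2)⌋₊ with hN
  set z : ℕ → ℝ := fun k => min b (a + k * (η / 2)) with hz
  have hab : a ≤ b := (hS b hb).1
  obtain ⟨m, u, hmono, hlt, h0, hm, hex⟩ := exists_partition_of_finset
    (S := S ∪ (Finset.range (N + 2)).image z) (Finset.mem_union_left _ ha)
    (Finset.mem_union_left _ hb) (by
      intro x hx
      rcases Finset.mem_union.1 hx with hx | hx
      · exact hS x hx
      · obtain ⟨k, -, rfl⟩ := Finset.mem_image.1 hx
        exact ⟨le_min hab (le_add_of_nonneg_right (by positivity)), min_le_left _ _⟩)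
  refine ⟨m, u, hmono, hlt, h0, hm, fun x hx => hex x (Finset.mem_union_left _ hx), ?_⟩
  intro i hi
  have hai : a ≤ u i := h0 ▸ hmono i.zero_le
  have hib : u (i + 1) ≤ b := hm ▸ hmono hi
  have hui := hlt i hi
  set k := ⌊(u i - a) / (η / 2)⌋₊ with hk
  have hkN : k ≤ N := Nat.floor_mono (by gcongr; linarith)
  have h1 : (k : ℝ) * (η / 2) ≤ u i - a :=
    (le_div_iff₀ hη2).1 (Nat.floor_le (div_nonneg (by linarith) hη2.le))
  have h2 : u i - a < ((k + 1 : ℕ) : ℝ) * (η / 2) := by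
    rw [← div_lt_iff₀ hη2]; push_cast; exact Nat.lt_floor_add_one _
  obtain ⟨j, -, hj⟩ := hex (z (k + 1)) (Finset.mem_union_right _
    (Finset.mem_image_of_mem _ (Finset.mem_range.2 (by omega))))
  -- The next point of the grid of step η/2 lies strictly beyond `u i`, at distance at most η/2, and
  -- belongs to the partition.
  have h3 : u i < u j := by rw [hj]; exact lt_min (by linarith) (by linarith)
  have h4 : u (i + 1) ≤ u j := hmono (hmono.reflect_lt h3)
  have h5 : u j ≤ a + ((k + 1 : ℕ) : ℝ) * (η / 2) := hj ▸ min_le_right _ _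
  push_cast at h5
  linarith

theorem ContinuousWithinAt.exists_isOpen_enorm_sub_le {X : Type*} [SeminormedAddCommGroup X]
    {φ : ℝ → X} {S : Set ℝ} {t : ℝ} (hφ : ContinuousWithinAt φ S t) {c : ℝ≥0} (hc : 0 < c) :
    ∃ U : Set ℝ, IsOpen U ∧ t ∈ U ∧ ∀ x ∈ U ∩ S, ∀ y ∈ U ∩ S, ‖φ x - φ y‖ₑ ≤ c := by
  have hball : ∀ᶠ x in nhdsWithin t (S), dist (φ x) (φ t) < c / 2 :=
    hφ.eventually (Metric.ball_mem_nhds _ (half_pos (NNReal.coe_pos.2 hc)))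
  obtain ⟨U, hUo, htU, hU⟩ := mem_nhdsWithin.1 hball
  refine ⟨U, hUo, htU, fun x hx y hy => ?_⟩
  have hxy : dist (φ x) (φ y) < c := by
    calc dist (φ x) (φ y) ≤ dist (φ x) (φ t) + dist (φ y) (φ t) := dist_triangle_right _ _ _
      _ < c / 2 + c / 2 := add_lt_add (hU hx) (hU hy)
      _ = c := add_halves _
  rw [enorm_eq_nnnorm, ENNReal.coe_le_coe, ← NNReal.coe_le_coe, coe_nnnorm, ← dist_eq_norm]
  exact hxy.le

/-- Near each point one of the two functions is continuous, so open sets on which one of them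
oscillates little cover [a,b]; η is a Lebesgue number of this cover. -/
theorem exists_small_oscillation {W W' : Type*} [SeminormedAddCommGroup W]
    [SeminormedAddCommGroup W'] {f : ℝ → W} {g : ℝ → W'} {a b : ℝ}
    (h : NoCommonDiscontinuity f g a b) {ω θ : ℝ≥0} (hω : 0 < ω) (hθ : 0 < θ) :
    ∃ η : ℝ, 0 < η ∧ ∀ s t, a ≤ s → s ≤ t → t ≤ b → t - s < η →
      (∀ x ∈ Set.Icc s t, ∀ y ∈ Set.Icc s t, ‖f x - f y‖ₑ ≤ ω) ∨
      ∀ x ∈ Set.Icc s t, ∀ y ∈ Set.Icc s t, ‖g x - g y‖ₑ ≤ θ := by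
  let ι := {U : Set ℝ // IsOpen U ∧
    ((∀ x ∈ U ∩ Set.Icc a b, ∀ y ∈ U ∩ Set.Icc a b, ‖f x - f y‖ₑ ≤ ω) ∨
      ∀ x ∈ U ∩ Set.Icc a b, ∀ y ∈ U ∩ Set.Icc a b, ‖g x - g y‖ₑ ≤ θ)}
  obtain ⟨η, hη, hball⟩ := lebesgue_number_lemma_of_metric (isCompact_Icc (a := a) (b := b))
    (c := fun U : ι => U.1) (fun U => U.2.1) (by
      intro t ht
      rw [Set.mem_iUnion]
      rcases h t ht with hc | hc
      · obtain ⟨U, hU, htU, h⟩ := hc.exists_isOpen_enorm_sub_le hω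
        exact ⟨⟨U, hU, Or.inl h⟩, htU⟩
      · obtain ⟨U, hU, htU, h⟩ := hc.exists_isOpen_enorm_sub_le hθ
        exact ⟨⟨U, hU, Or.inr h⟩, htU⟩)
  refine ⟨η, hη, fun s t has hst htb hts => ?_⟩
  obtain ⟨U, hU⟩ := hball s ⟨has, hst.trans htb⟩
  have hsub : Set.Icc s t ⊆ U.1 ∩ Set.Icc a b := fun x hx =>
    ⟨hU (by rw [Metric.mem_ball, Real.dist_eq, abs_of_nonneg (by linarith [hx.1])]
            linarith [hx.2]), has.trans hx.1, hx.2.trans htb⟩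
  exact U.2.2.imp (fun h x hx y hy => h x (hsub hx) y (hsub hy))
    fun h x hx y hy => h x (hsub hx) y (hsub hy)

end Partitions

/-! ### Existence of the integral and its increments. -/

section Integral

variable {𝕜 E V : Type*} [RCLike 𝕜] [NormedAddCommGroup E] [NormedSpace 𝕜 E]
  [NormedAddCommGroup V] [NormedSpace 𝕜 V]

theorem sum_range_eq_sum_blocks {A : Type*} [AddCommMonoid A] (F : ℕ → A) {τ : ℕ → ℕ}
    (h0 : τ 0 = 0) : ∀ n, (∀ i < n, τ i ≤ τ (i + 1)) →
      ∑ j ∈ Finset.range (τ n), F j =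
        ∑ i ∈ Finset.range n, ∑ j ∈ Finset.Ico (τ i) (τ (i + 1)), F j
  | 0, _ => by simp [h0]
  | n + 1, h => by
    rw [Finset.sum_range_succ, ← sum_range_eq_sum_blocks F h0 n fun i hi => h i (by omega),
      Finset.sum_range_add_sum_Ico _ (h n (by omega))]

/-- Comparison of a tagged Riemann–Stieltjes sum with the left-point sum along a refinement. -/
theorem enorm_sub_refinement_le {f : ℝ → E →L[𝕜] V} {g : ℝ → E} {ρ σ ω θ : ℝ≥0}
    (hρ : ρ < 1) (hσ : σ < 1) {n m : ℕ} {t ξ u : ℕ → ℝ} (hu : Monotone u)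
    (hlt : ∀ i < m, u i < u (i + 1)) (hu0 : u 0 = t 0) (hum : u m = t n)
    (ht : ∀ i < n, t i < t (i + 1)) (hξ : ∀ i < n, ξ i ∈ Set.Icc (t i) (t (i + 1)))
    (hex : ∀ i ≤ n, ∃ j ≤ m, u j = t i)
    (h : ∀ i < n, (∀ x ∈ Set.Icc (t i) (t (i + 1)), ∀ y ∈ Set.Icc (t i) (t (i + 1)),
        ‖f x - f y‖ₑ ≤ ω) ∨
      ∀ x ∈ Set.Icc (t i) (t (i + 1)), ∀ y ∈ Set.Icc (t i) (t (i + 1)), ‖g x - g y‖ₑ ≤ θ) :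
    ‖∑ i ∈ Finset.range n, f (ξ i) (g (t (i + 1)) - g (t i)) -
      ∑ j ∈ Finset.range m, f (u j) (g (u (j + 1)) - g (u j))‖ₑ ≤
      16 * youngGauge ρ σ ω θ f g (t 0) (t n) := by
  have hinj : ∀ i ≤ m, ∀ j ≤ m, u i = u j → i = j := by
    intro i hi j hj hij
    rcases lt_trichotomy i j with hlt' | rfl | hlt'
    · exact absurd hij ((hlt i (by omega)).trans_le (hu hlt')).ne
    · rfl
    · exact absurd hij ((hlt j (by omega)).trans_le (hu hlt')).ne'
  choose! τ hτm hτ using hex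
  have hτ0 : τ 0 = 0 := hinj _ (hτm 0 n.zero_le) _ m.zero_le (by rw [hτ 0 n.zero_le, hu0])
  have hτn : τ n = m := hinj _ (hτm n le_rfl) _ le_rfl (by rw [hτ n le_rfl, hum])
  have hτs : ∀ i < n, τ i ≤ τ (i + 1) := fun i hi =>
    (hu.reflect_lt (by rw [hτ i hi.le, hτ (i + 1) hi]; exact ht i hi)).le
  rw [← hτn, sum_range_eq_sum_blocks _ hτ0 n hτs, ← Finset.sum_sub_distrib]
  refine (enorm_sum_le _ _).trans ?_
  calc _ ≤ ∑ i ∈ Finset.range n, 16 * youngGauge ρ σ ω θ f g (t i) (t (i + 1)) := by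
        refine Finset.sum_le_sum fun i hi => ?_
        have hin : i < n := Finset.mem_range.1 hi
        have hb := enorm_block_le_youngGauge (f := f) (g := g) (ω := ω) (θ := θ) hρ hσ hu
          (hτs i hin) (by rw [hτ i hin.le, hτ (i + 1) hin]; exact h i hin)
        rw [hτ i hin.le, hτ (i + 1) hin] at hb
        have hp := enorm_apply_le_youngGauge (f := f) (g := g) (ω := ω) (θ := θ) hρ hσ
          (h i hin) (hξ i hin)
        -- Moving the tag to the left endpoint and subdividing the interval each cost 8 times the
        -- gauge.
        have hsplit : ∀ B : V, f (ξ i) (g (t (i + 1)) - g (t i)) - B =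
            (f (ξ i) - f (t i)) (g (t (i + 1)) - g (t i)) -
              (B - f (t i) (g (t (i + 1)) - g (t i))) := by
          intro B
          rw [sub_apply]
          abel
        rw [hsplit]
        refine enorm_sub_le.trans ((add_le_add hp hb).trans (le_of_eq ?_))
        ring
    _ ≤ _ := by
        rw [← Finset.mul_sum]
        gcongr
        exact sum_le_of_superadditive (T := youngGauge ρ σ ω θ f g) youngGauge_add_le n
          fun i hi => (ht i hi).le

theorem le_of_chain {t : ℕ → ℝ} {n : ℕ} (ht : ∀ i < n, t i < t (i + 1)) {i j : ℕ} (hij : i ≤ j)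
    (hj : j ≤ n) : t i ≤ t j := by
  induction j, hij using Nat.le_induction with
  | base => exact le_rfl
  | succ k _ ih => exact (ih (by omega)).trans (ht k (by omega)).le

theorem cauchy_rsSums {f : ℝ → E →L[𝕜] V} {g : ℝ → E} {ρ σ : ℝ≥0} {a b : ℝ} (hρ : ρ < 1)
    (hσ : σ < 1) (hfg : NoCommonDiscontinuity f g a b)
    (hsmall : ∀ ε : ℝ≥0∞, 0 < ε →
      ∃ ω θ : ℝ≥0, 0 < ω ∧ 0 < θ ∧ 32 * youngGauge ρ σ ω θ f g a b < ε) {ε : ℝ} (hε : 0 < ε) :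
    ∃ η : ℝ, 0 < η ∧ ∀ (n n' : ℕ) (t ξ t' ξ' : ℕ → ℝ), t 0 = a → t n = b → t' 0 = a → t' n' = b →
      (∀ i < n, t i < t (i + 1)) → (∀ i < n', t' i < t' (i + 1)) →
      (∀ i < n, ξ i ∈ Set.Icc (t i) (t (i + 1))) →
      (∀ i < n', ξ' i ∈ Set.Icc (t' i) (t' (i + 1))) →
      (∀ i < n, t (i + 1) - t i < η) → (∀ i < n', t' (i + 1) - t' i < η) →
      ‖∑ i ∈ Finset.range n, f (ξ i) (g (t (i + 1)) - g (t i)) -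
        ∑ i ∈ Finset.range n', f (ξ' i) (g (t' (i + 1)) - g (t' i))‖ < ε := by
  classical
  obtain ⟨ω, θ, hω, hθ, hlt⟩ := hsmall (ENNReal.ofReal ε) (ENNReal.ofReal_pos.2 hε)
  obtain ⟨η, hη, hosc⟩ := exists_small_oscillation hfg hω hθ
  refine ⟨η, hη, fun n n' t ξ t' ξ' h0 hn h0' hn' ht ht' hξ hξ' hm hm' => ?_⟩
  -- Both sums are compared with the left-point sum over the common refinement, whence 32 = 16 + 16.
  obtain ⟨m, u, hu, hult, hu0, hum, hex⟩ := exists_partition_of_finset (a := a) (b := b)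
    (S := (Finset.range (n + 1)).image t ∪ (Finset.range (n' + 1)).image t')
    (Finset.mem_union_left _ (Finset.mem_image.2 ⟨0, by simp, h0⟩))
    (Finset.mem_union_left _ (Finset.mem_image.2 ⟨n, by simp, hn⟩)) (by
      intro x hx
      rcases Finset.mem_union.1 hx with hx | hx <;>
      obtain ⟨k, hk, rfl⟩ := Finset.mem_image.1 hx <;>
      have hk := Nat.lt_succ_iff.1 (Finset.mem_range.1 hk)
      · exact ⟨h0 ▸ le_of_chain ht k.zero_le hk, hn ▸ le_of_chain ht hk le_rfl⟩
      · exact ⟨h0' ▸ le_of_chain ht' k.zero_le hk, hn' ▸ le_of_chain ht' hk le_rfl⟩)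
  have e1 := enorm_sub_refinement_le (f := f) (g := g) (ω := ω) (θ := θ) hρ hσ hu hult
    (hu0.trans h0.symm) (hum.trans hn.symm) ht hξ
    (fun i hi => hex _ (Finset.mem_union_left _
      (Finset.mem_image_of_mem _ (Finset.mem_range.2 (by omega)))))
    fun i hi => hosc _ _ (h0 ▸ le_of_chain ht i.zero_le hi.le) (ht i hi).le
      (hn ▸ le_of_chain ht hi le_rfl) (hm i hi)
  have e2 := enorm_sub_refinement_le (f := f) (g := g) (ω := ω) (θ := θ) hρ hσ hu hult
    (hu0.trans h0'.symm) (hum.trans hn'.symm) ht' hξ'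
    (fun i hi => hex _ (Finset.mem_union_right _
      (Finset.mem_image_of_mem _ (Finset.mem_range.2 (by omega)))))
    fun i hi => hosc _ _ (h0' ▸ le_of_chain ht' i.zero_le hi.le) (ht' i hi).le
      (hn' ▸ le_of_chain ht' hi le_rfl) (hm' i hi)
  rw [h0, hn] at e1
  rw [h0', hn'] at e2
  rw [← ENNReal.ofReal_lt_ofReal_iff hε, ofReal_norm]
  refine lt_of_le_of_lt ?_ hlt
  rw [← sub_sub_sub_cancel_right _ _
    (∑ j ∈ Finset.range m, f (u j) (g (u (j + 1)) - g (u j)))]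
  refine enorm_sub_le.trans ((add_le_add e1 e2).trans (le_of_eq ?_))
  ring

theorem exists_hasRSIntegral [CompleteSpace V] {f : ℝ → E →L[𝕜] V} {g : ℝ → E} {ρ σ : ℝ≥0}
    {a b : ℝ} (hab : a ≤ b) (hρ : ρ < 1) (hσ : σ < 1) (hfg : NoCommonDiscontinuity f g a b)
    (hsmall : ∀ ε : ℝ≥0∞, 0 < ε →
      ∃ ω θ : ℝ≥0, 0 < ω ∧ 0 < θ ∧ 32 * youngGauge ρ σ ω θ f g a b < ε) :
    ∃ v, HasRSIntegral f g a b v := by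
  have hfine : ∀ k : ℕ, ∃ (m : ℕ) (u : ℕ → ℝ), Monotone u ∧ (∀ i < m, u i < u (i + 1)) ∧
      u 0 = a ∧ u m = b ∧ (∀ x ∈ ({a, b} : Finset ℝ), ∃ j ≤ m, u j = x) ∧
      ∀ i < m, u (i + 1) - u i < 1 / ((k : ℝ) + 1) := fun k =>
    exists_fine_partition (by simp) (by simp) (by simp [hab]) Nat.one_div_pos_of_nat
  choose m u hu hlt h0 hm _ hmesh using hfine
  have htag : ∀ k, ∀ i < m k, u k i ∈ Set.Icc (u k i) (u k (i + 1)) :=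
    fun k i hi => ⟨le_rfl, (hlt k i hi).le⟩
  set x : ℕ → V := fun k =>
    ∑ i ∈ Finset.range (m k), f (u k i) (g (u k (i + 1)) - g (u k i)) with hx
  have hmesh' : ∀ η : ℝ, 0 < η → ∃ K : ℕ, ∀ k ≥ K, ∀ i < m k, u k (i + 1) - u k i < η := by
    intro η hη
    obtain ⟨K, hK⟩ := exists_nat_one_div_lt hη
    exact ⟨K, fun k hk i hi => (hmesh k i hi).trans
      ((Nat.one_div_le_one_div hk).trans_lt hK)⟩
  have hcauchy : CauchySeq x := by
    rw [Metric.cauchySeq_iff]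
    intro ε hε
    obtain ⟨η, hη, hcmp⟩ := cauchy_rsSums hρ hσ hfg hsmall hε
    obtain ⟨K, hK⟩ := hmesh' η hη
    refine ⟨K, fun k hk l hl => ?_⟩
    rw [dist_eq_norm]
    exact hcmp _ _ _ _ _ _ (h0 k) (hm k) (h0 l) (hm l) (hlt k) (hlt l) (htag k) (htag l)
      (hK k hk) (hK l hl)
  obtain ⟨v, hv⟩ := cauchySeq_tendsto_of_complete hcauchy
  refine ⟨v, fun ε hε => ?_⟩
  obtain ⟨η, hη, hcmp⟩ := cauchy_rsSums hρ hσ hfg hsmall (half_pos hε)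
  obtain ⟨K, hK⟩ := hmesh' η hη
  refine ⟨η, hη, fun n t ξ ht0 htn ht hξ hmt => ?_⟩
  refine lt_of_le_of_lt ?_ (half_lt_self hε)
  refine le_of_tendsto ((tendsto_const_nhds.sub hv).norm) ?_
  filter_upwards [Filter.eventually_ge_atTop K] with k hk
  exact (hcmp _ _ _ _ _ _ ht0 htn (h0 k) (hm k) ht (hlt k) hξ (htag k) hmt (hK k hk)).le

/-- The increments of an indefinite Riemann–Stieltjes integral. -/
theorem enorm_increment_le {f : ℝ → E →L[𝕜] V} {g : ℝ → E} {ρ σ ω θ : ℝ≥0} {a s t : ℝ}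
    {v w : V} (hρ : ρ < 1) (hσ : σ < 1) (has : a ≤ s) (hst : s ≤ t)
    (hv : HasRSIntegral f g a s v) (hw : HasRSIntegral f g a t w)
    (hω : ∀ x ∈ Set.Icc s t, ∀ y ∈ Set.Icc s t, ‖f x - f y‖ₑ ≤ ω) :
    ‖w - v - f s (g t - g s)‖ₑ ≤ 8 * youngGauge ρ σ ω θ f g s t := by
  refine ENNReal.le_of_forall_pos_le_add fun ε hε _ => ?_
  have hε2 : (0 : ℝ) < ε / 2 := half_pos hε
  obtain ⟨η, hη, h⟩ := hv _ hε2
  obtain ⟨η', hη', h'⟩ := hw _ hε2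
  -- A fine partition of [a,t] through s approximates both integrals, and their difference is then a
  -- block sum over [s,t].
  obtain ⟨m, u, hu, hlt, h0, hm, hex, hmesh⟩ := exists_fine_partition (S := {a, s, t}) (a := a)
    (b := t) (η := min η η') (by simp) (by simp) (by simp [has, hst, has.trans hst])
    (lt_min hη hη')
  obtain ⟨j, hjm, hj⟩ := hex s (by simp)
  have htag : ∀ i < m, u i ∈ Set.Icc (u i) (u (i + 1)) := fun i hi => ⟨le_rfl, (hlt i hi).le⟩
  have e1 := h j u u h0 hj (fun i hi => hlt i (by omega)) (fun i hi => htag i (by omega))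
    fun i hi => (hmesh i (by omega)).trans_le (min_le_left _ _)
  have e2 := h' m u u h0 hm hlt htag fun i hi => (hmesh i hi).trans_le (min_le_right _ _)
  have e3 := enorm_block_le_youngGauge (f := f) (g := g) (ω := ω) (θ := θ) hρ hσ hu hjm
    (Or.inl (by rw [hj, hm]; exact hω))
  rw [hj, hm] at e3
  rw [← Finset.sum_range_add_sum_Ico _ hjm] at e2
  set A := ∑ i ∈ Finset.range j, f (u i) (g (u (i + 1)) - g (u i))
  set B := ∑ i ∈ Finset.Ico j m, f (u i) (g (u (i + 1)) - g (u i))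
  have hsplit : w - v - f s (g t - g s) =
      (B - f s (g t - g s)) + ((A - v) - (A + B - w)) := by abel
  rw [hsplit]
  refine (enorm_add_le _ _).trans (add_le_add e3 ?_)
  rw [← ofReal_norm, ← ENNReal.ofReal_coe_nnreal]
  refine ENNReal.ofReal_le_ofReal ((norm_sub_le _ _).trans ?_)
  linarith

end Integral

/-! ### Bounds on the gauge and choice of the geometric ratios. -/

section GaugeBounds

/-- The constant in `youngGauge_le`. -/
noncomputable def gaugeConst (ρ σ : ℝ≥0) (p q : ℝ) : ℝ≥0 :=
  (2 ^ (1 - q))⁻¹ * σ ^ (1 - q) * (1 - ρ * σ ^ (1 - q))⁻¹ +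
    (2 ^ (1 - p))⁻¹ * (1 - σ * ρ ^ (1 - p))⁻¹

theorem tsum_coe_geometric {r : ℝ≥0} (hr : r < 1) :
    ∑' k : ℕ, ((r ^ k : ℝ≥0) : ℝ≥0∞) = (((1 - r)⁻¹ : ℝ≥0) : ℝ≥0∞) := by
  simp_rw [ENNReal.coe_pow]
  rw [ENNReal.tsum_geometric, ENNReal.coe_inv (tsub_pos_of_lt hr).ne', ENNReal.coe_sub,
    ENNReal.coe_one]

theorem nnrpow_pow_comm (x : ℝ≥0) (k : ℕ) (y : ℝ) : (x ^ k) ^ y = (x ^ y) ^ k := by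
  rw [← NNReal.rpow_natCast, ← NNReal.rpow_mul, mul_comm, NNReal.rpow_mul, NNReal.rpow_natCast]

theorem youngGauge_le {W W' : Type*} [SeminormedAddCommGroup W] [SeminormedAddCommGroup W']
    {p q : ℝ} {ρ σ ω θ : ℝ≥0} (hρ : 0 < ρ) (hσ : 0 < σ) (hω : 0 < ω) (hθ : 0 < θ)
    (h1 : ρ * σ ^ (1 - q) < 1) (h2 : σ * ρ ^ (1 - p) < 1) (f : ℝ → W) (g : ℝ → W') (a b : ℝ) :
    youngGauge ρ σ ω θ f g a b ≤ gaugeConst ρ σ p q *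
      ((ω * θ ^ (1 - q) : ℝ≥0) * supTV q g a b + (θ * ω ^ (1 - p) : ℝ≥0) * supTV p f a b) := by
  set r := ρ * σ ^ (1 - q)
  set r' := σ * ρ ^ (1 - p)
  set A : ℝ≥0 := (2 ^ (1 - q))⁻¹ * σ ^ (1 - q) with hA
  set B : ℝ≥0 := (2 ^ (1 - p))⁻¹ with hB
  have hg : ∀ k : ℕ, ((ω * ρ ^ k : ℝ≥0) : ℝ≥0∞) * truncVar g a b (θ * σ ^ (k + 1) / 2) ≤
      (A * (ω * θ ^ (1 - q)) : ℝ≥0) * supTV q g a b * (r ^ k : ℝ≥0) := by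
    intro k
    calc _ ≤ ((ω * ρ ^ k : ℝ≥0) : ℝ≥0∞) *
          ((((θ * σ ^ (k + 1) / 2) ^ (1 - q) : ℝ≥0) : ℝ≥0∞) * supTV q g a b) := by
          gcongr
          exact truncVar_le_supTV q (by positivity)
      _ = ((ω * ρ ^ k * (θ * σ ^ (k + 1) / 2) ^ (1 - q) : ℝ≥0) : ℝ≥0∞) * supTV q g a b := by
          rw [← mul_assoc, ← ENNReal.coe_mul]
      _ = ((A * (ω * θ ^ (1 - q)) * r ^ k : ℝ≥0) : ℝ≥0∞) * supTV q g a b := by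
          congr 2
          rw [NNReal.div_rpow, NNReal.mul_rpow, nnrpow_pow_comm, mul_pow, pow_succ, div_eq_mul_inv]
          ring
      _ = _ := by
          rw [ENNReal.coe_mul _ (r ^ k)]
          ring
  have hf : ∀ k : ℕ, ((θ * σ ^ k : ℝ≥0) : ℝ≥0∞) * truncVar f a b (ω * ρ ^ k / 2) ≤
      (B * (θ * ω ^ (1 - p)) : ℝ≥0) * supTV p f a b * (r' ^ k : ℝ≥0) := by
    intro k
    calc _ ≤ ((θ * σ ^ k : ℝ≥0) : ℝ≥0∞) *
          ((((ω * ρ ^ k / 2) ^ (1 - p) : ℝ≥0) : ℝ≥0∞) * supTV p f a b) := by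
          gcongr
          exact truncVar_le_supTV p (by positivity)
      _ = ((θ * σ ^ k * (ω * ρ ^ k / 2) ^ (1 - p) : ℝ≥0) : ℝ≥0∞) * supTV p f a b := by
          rw [← mul_assoc, ← ENNReal.coe_mul]
      _ = ((B * (θ * ω ^ (1 - p)) * r' ^ k : ℝ≥0) : ℝ≥0∞) * supTV p f a b := by
          congr 2
          rw [NNReal.div_rpow, NNReal.mul_rpow, nnrpow_pow_comm, mul_pow, div_eq_mul_inv]
          ring
      _ = _ := by
          rw [ENNReal.coe_mul _ (r' ^ k)]
          ring
  have hC1 : A * (1 - r)⁻¹ ≤ gaugeConst ρ σ p q := le_self_add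
  have hC2 : B * (1 - r')⁻¹ ≤ gaugeConst ρ σ p q := le_add_self
  calc youngGauge ρ σ ω θ f g a b
      ≤ ∑' k : ℕ, ((A * (ω * θ ^ (1 - q)) : ℝ≥0) * supTV q g a b * (r ^ k : ℝ≥0) +
          (B * (θ * ω ^ (1 - p)) : ℝ≥0) * supTV p f a b * (r' ^ k : ℝ≥0)) :=
        ENNReal.tsum_le_tsum fun k => add_le_add (hg k) (hf k)
    _ = (A * (1 - r)⁻¹ : ℝ≥0) * ((ω * θ ^ (1 - q) : ℝ≥0) * supTV q g a b) +
          (B * (1 - r')⁻¹ : ℝ≥0) * ((θ * ω ^ (1 - p) : ℝ≥0) * supTV p f a b) := by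
        rw [ENNReal.tsum_add, ENNReal.tsum_mul_left, ENNReal.tsum_mul_left,
          tsum_coe_geometric h1, tsum_coe_geometric h2, ENNReal.coe_mul A, ENNReal.coe_mul A,
          ENNReal.coe_mul B, ENNReal.coe_mul B]
        ring
    _ ≤ _ := by
        rw [mul_add]
        gcongr

theorem exists_youngGauge_lt {W W' : Type*} [SeminormedAddCommGroup W]
    [SeminormedAddCommGroup W'] {p q : ℝ} {ρ σ : ℝ≥0} (hρ : 0 < ρ) (hσ : 0 < σ)
    (h1 : ρ * σ ^ (1 - q) < 1) (h2 : σ * ρ ^ (1 - p) < 1) {f : ℝ → W} {g : ℝ → W'} {a b : ℝ}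
    (hf : MemU p f a b) (hg : MemU q g a b) {ε : ℝ≥0∞} (hε : 0 < ε) :
    ∃ ω θ : ℝ≥0, 0 < ω ∧ 0 < θ ∧ 32 * youngGauge ρ σ ω θ f g a b < ε := by
  have hgeom : ∀ {r : ℝ≥0} {M : ℝ≥0∞}, r < 1 → M < ∞ →
      Filter.Tendsto (fun k : ℕ => ((r ^ k : ℝ≥0) : ℝ≥0∞) * M) Filter.atTop (nhds 0) := by
    intro r M hr hM
    have := ENNReal.Tendsto.mul_const (b := M)
      (ENNReal.tendsto_coe.2 (NNReal.tendsto_pow_atTop_nhds_zero_of_lt_one hr)) (Or.inr hM.ne)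
    rwa [ENNReal.coe_zero, zero_mul] at this
  have hlim := ENNReal.Tendsto.const_mul (a := ((32 * gaugeConst ρ σ p q : ℝ≥0) : ℝ≥0∞))
    ((hgeom h1 hg).add (hgeom h2 hf)) (Or.inr ENNReal.coe_ne_top)
  rw [add_zero, mul_zero] at hlim
  obtain ⟨k, hk⟩ := (hlim.eventually_lt_const hε).exists
  -- With ω = ρ^k and θ = σ^k the factors ω θ^(1-q) and θ ω^(1-p) are the k-th powers of the two
  -- ratios, hence tend to 0.
  refine ⟨ρ ^ k, σ ^ k, by positivity, by positivity, lt_of_le_of_lt ?_ hk⟩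
  refine (mul_le_mul_right (youngGauge_le hρ hσ (pow_pos hρ k) (pow_pos hσ k) h1 h2 f g a b)
    32).trans (le_of_eq ?_)
  rw [nnrpow_pow_comm, nnrpow_pow_comm, ← mul_pow, ← mul_pow, ENNReal.coe_mul, mul_assoc]
  rfl

/-- If c is half the increment, the single step s, t gives c ≤ TV^c ≤ c^(1-p) F^p, that is, c ≤ F.
-/
theorem enorm_sub_le_of_supTV_le {W : Type*} [SeminormedAddCommGroup W] {p : ℝ} {f : ℝ → W}
    {a b : ℝ} {F : ℝ≥0} (hp : 0 < p) (hF : supTV p f a b ≤ (F ^ p : ℝ≥0)) {s t : ℝ}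
    (hs : a ≤ s) (hst : s ≤ t) (ht : t ≤ b) : ‖f t - f s‖ₑ ≤ ((2 * F : ℝ≥0) : ℝ≥0∞) := by
  rw [enorm_eq_nnnorm, ENNReal.coe_le_coe]
  by_contra! hlt
  set c : ℝ≥0 := ‖f t - f s‖₊ / 2 with hc
  have hv : ‖f t - f s‖₊ = c + c := (add_halves _).symm
  have hFc : F < c := by
    rw [hv, two_mul] at hlt
    by_contra! h
    exact absurd hlt (not_lt.2 (add_le_add h h))
  have hc0 : 0 < c := zero_le.trans_lt hFc
  have hI : ∀ i : ℕ, (if i = 0 then s else t) ∈ Set.Icc a b := by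
    intro i
    split_ifs
    exacts [⟨hs, hst.trans ht⟩, ⟨hs.trans hst, ht⟩]
  have hm : Monotone fun i : ℕ => if i = 0 then s else t :=
    monotone_nat_of_le_succ fun i => by by_cases hi : i = 0 <;> simp [hi, hst]
  have h := (sum_le_truncVar (f := f) c 1 hm hI).trans ((truncVar_le_supTV p hc0).trans
    (mul_le_mul_right hF _))
  simp only [Finset.sum_range_one, zero_add, one_ne_zero, if_true, if_false] at h
  rw [enorm_eq_nnnorm, ← ENNReal.coe_sub, ← ENNReal.coe_mul, ENNReal.coe_le_coe, hv,
    add_tsub_cancel_right] at h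
  refine absurd h (not_le.2 ?_)
  calc c ^ (1 - p) * F ^ p < c ^ (1 - p) * c ^ p := by
        have := NNReal.rpow_pos (p := 1 - p) hc0
        gcongr
    _ = c := by rw [← NNReal.rpow_add hc0.ne', sub_add_cancel, NNReal.rpow_one]

/-- With σ = ρ^s the requirements become p - 1 < s < 1/(q - 1); such an s exists because (p-1)(q-1)
< 1. -/
theorem exists_ratios {p q : ℝ} (hp : 1 < p) (hq : 1 < q) (hpq : 1 < p⁻¹ + q⁻¹) :
    ∃ ρ σ : ℝ≥0, 0 < ρ ∧ ρ < 1 ∧ 0 < σ ∧ σ < 1 ∧ ρ * σ ^ (1 - q) < 1 ∧ σ * ρ ^ (1 - p) < 1 := by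
  have hp0 : 0 < p := by linarith
  have hq0 : 0 < q := by linarith
  have hq1 : 0 < q - 1 := by linarith
  have hpq' : (p - 1) * (q - 1) < 1 := by
    have h : p⁻¹ + q⁻¹ = (p + q) / (p * q) := by field_simp; ring
    rw [h, lt_div_iff₀ (by positivity)] at hpq
    linarith
  obtain ⟨s, hs1, hs2⟩ := exists_between ((lt_div_iff₀ hq1).2 hpq')
  have hs : 0 < s := by linarith
  rw [lt_div_iff₀ hq1] at hs2
  have hhalf : (0 : ℝ≥0) < 1 / 2 := by positivity
  have hhalf1 : (1 / 2 : ℝ≥0) < 1 := NNReal.half_lt_self one_ne_zero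
  refine ⟨1 / 2, (1 / 2) ^ s, hhalf, hhalf1, NNReal.rpow_pos hhalf,
    NNReal.rpow_lt_one hhalf1 hs, ?_, ?_⟩
  · rw [← NNReal.rpow_mul, ← NNReal.rpow_one_add' (by nlinarith)]
    exact NNReal.rpow_lt_one hhalf1 (by nlinarith)
  · rw [← NNReal.rpow_add hhalf.ne']
    exact NNReal.rpow_lt_one hhalf1 (by linarith)

end GaugeBounds

/-! ### The q-TV estimate of the indefinite integral. -/

section MainEstimate

/-- Only y > c matters, and then (X/c)^(q-1) ≥ 1. This turns a bound on a plain sum into the power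
c^(1-q) needed for q-TV. -/
theorem tsub_le_rpow_mul {y : ℝ≥0∞} {X c : ℝ≥0} {q : ℝ} (hq : 1 < q) (hc : 0 < c) (hy : y ≤ X) :
    y - c ≤ ((c ^ (1 - q) * X ^ (q - 1) : ℝ≥0) : ℝ≥0∞) * y := by
  lift y to ℝ≥0 using ne_top_of_le_ne_top ENNReal.coe_ne_top hy
  rw [ENNReal.coe_le_coe] at hy
  rw [← ENNReal.coe_sub, ← ENNReal.coe_mul, ENNReal.coe_le_coe]
  rcases le_total y c with h | h
  · rw [tsub_eq_zero_of_le h]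
    exact zero_le
  · calc y - c ≤ 1 * y := by rw [one_mul]; exact tsub_le_self
      _ = c ^ (1 - q) * c ^ (q - 1) * y := by
        rw [← NNReal.rpow_add hc.ne', sub_add_sub_cancel, sub_self, NNReal.rpow_zero]
      _ ≤ _ := by
        gcongr
        exact h.trans hy

variable {𝕜 E V : Type*} [RCLike 𝕜] [NormedAddCommGroup E] [NormedSpace 𝕜 E]
  [NormedAddCommGroup V] [NormedSpace 𝕜 V]

theorem gaugeConst_bound {p q : ℝ} (hp : 1 < p) (hq : 1 < q) {W W' : Type*}
    [SeminormedAddCommGroup W] [SeminormedAddCommGroup W'] {ρ σ : ℝ≥0} (hρ : 0 < ρ) (hσ : 0 < σ)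
    (h1 : ρ * σ ^ (1 - q) < 1) (h2 : σ * ρ ^ (1 - p) < 1) {f : ℝ → W} {g : ℝ → W'} {a b : ℝ}
    {F G ω : ℝ≥0} (hF0 : 0 < F) (hG0 : 0 < G) (hω0 : 0 < ω)
    (hF : supTV p f a b ≤ (F ^ p : ℝ≥0)) (hG : supTV q g a b ≤ (G ^ q : ℝ≥0)) :
    ∃ θ : ℝ≥0, youngGauge ρ σ ω θ f g a b ≤
      ((2 * gaugeConst ρ σ p q * (F ^ (p - p / q) * ω ^ (1 + p / q - p) * G) : ℝ≥0) : ℝ≥0∞) := by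
  have hq0 : q ≠ 0 := by linarith
  -- This θ solves ω θ^(1-q) G^q = θ ω^(1-p) F^p, so the two parts of the gauge bound coincide.
  set θ : ℝ≥0 := ω ^ (p / q) * F ^ (-(p / q)) * G with hθ
  have hθ0 : 0 < θ := by
    have := NNReal.rpow_pos (p := p / q) hω0
    have := NNReal.rpow_pos (p := -(p / q)) hF0
    positivity
  have e1 : ω * θ ^ (1 - q) * G ^ q = F ^ (p - p / q) * ω ^ (1 + p / q - p) * G := by
    have hω : ω * ω ^ (p / q * (1 - q)) = ω ^ (1 + p / q - p) := by
      nth_rewrite 1 [← NNReal.rpow_one ω]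
      rw [← NNReal.rpow_add hω0.ne']
      congr 1
      field_simp
      ring
    have hF : F ^ (-(p / q) * (1 - q)) = F ^ (p - p / q) := by
      congr 1
      field_simp
      ring
    have hG : G ^ (1 - q) * G ^ q = G := by
      rw [← NNReal.rpow_add hG0.ne', sub_add_cancel, NNReal.rpow_one]
    rw [hθ, NNReal.mul_rpow, NNReal.mul_rpow, ← NNReal.rpow_mul, ← NNReal.rpow_mul, hF, ← hω]
    calc _ = F ^ (p - p / q) * (ω * ω ^ (p / q * (1 - q))) * (G ^ (1 - q) * G ^ q) := by ring
      _ = _ := by rw [hG]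
  have e2 : θ * ω ^ (1 - p) * F ^ p = F ^ (p - p / q) * ω ^ (1 + p / q - p) * G := by
    have hω : ω ^ (p / q) * ω ^ (1 - p) = ω ^ (1 + p / q - p) := by
      rw [← NNReal.rpow_add hω0.ne']
      congr 1
      ring
    have hF : F ^ (-(p / q)) * F ^ p = F ^ (p - p / q) := by
      rw [← NNReal.rpow_add hF0.ne']
      congr 1
      ring
    rw [hθ, ← hω, ← hF]
    ring
  refine ⟨θ, (youngGauge_le hρ hσ hω0 hθ0 h1 h2 f g a b).trans ?_⟩
  calc _ ≤ (gaugeConst ρ σ p q : ℝ≥0∞) * ((ω * θ ^ (1 - q) : ℝ≥0) * (G ^ q : ℝ≥0) +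
        (θ * ω ^ (1 - p) : ℝ≥0) * (F ^ p : ℝ≥0)) := by gcongr
    _ = _ := by
      rw [← ENNReal.coe_mul, ← ENNReal.coe_mul, e1, e2, ← ENNReal.coe_add, ← ENNReal.coe_mul]
      congr 1
      ring

/-- The constant in the estimate of the indefinite integral. -/
noncomputable def integralConst (ρ σ : ℝ≥0) (p q : ℝ) : ℝ≥0 :=
  2 * (16 * gaugeConst ρ σ p q + 2 ^ (p - p / q))

theorem supTV_integral_le {p q : ℝ} (hp : 1 < p) (hq : 1 < q) {ρ σ : ℝ≥0} (hρ : 0 < ρ)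
    (hρ1 : ρ < 1) (hσ : 0 < σ) (hσ1 : σ < 1) (h1 : ρ * σ ^ (1 - q) < 1)
    (h2 : σ * ρ ^ (1 - p) < 1) {f : ℝ → E →L[𝕜] V} {g : ℝ → E} {I : ℝ → V} {a b : ℝ}
    {F G ω : ℝ≥0} (hF0 : 0 < F) (hG0 : 0 < G) (hω0 : 0 < ω)
    (hF : supTV p f a b ≤ (F ^ p : ℝ≥0)) (hG : supTV q g a b ≤ (G ^ q : ℝ≥0))
    (hω : ∀ x ∈ Set.Icc a b, ∀ y ∈ Set.Icc a b, ‖f x - f y‖ₑ ≤ ω) (hωF : ω ≤ 2 * F)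
    (hfa : f a = 0) (hI : ∀ t ∈ Set.Icc a b, HasRSIntegral f g a t (I t)) :
    supTV q I a b ≤ (((integralConst ρ σ p q *
      (F ^ (p - p / q) * ω ^ (1 + p / q - p) * G)) ^ q : ℝ≥0) : ℝ≥0∞) := by
  obtain ⟨θ, hθ⟩ := gaugeConst_bound hp hq hρ hσ h1 h2 hF0 hG0 hω0 hF hG
  have hq0 : 0 < q := by linarith
  set Y : ℝ≥0 := F ^ (p - p / q) * ω ^ (1 + p / q - p) * G with hY
  set X : ℝ≥0 := 16 * gaugeConst ρ σ p q * Y with hX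
  have hΦX : 8 * youngGauge ρ σ ω θ f g a b ≤ X := by
    refine (mul_le_mul_right hθ 8).trans (le_of_eq ?_)
    rw [← ENNReal.coe_ofNat, ← ENNReal.coe_mul, hX]
    congr 1
    ring
  -- The two exponents in Y add up to 1, so replacing part of ω by 2F puts ωG in the same form as
  -- the gauge bound.
  have hωG : ω * G ≤ 2 ^ (p - p / q) * Y := by
    have hα : 0 ≤ p - p / q := sub_nonneg.2 (div_le_self (by linarith) hq.le)
    calc ω * G = ω ^ (p - p / q) * ω ^ (1 + p / q - p) * G := by
          rw [← NNReal.rpow_add hω0.ne']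
          norm_num
      _ ≤ (2 * F) ^ (p - p / q) * ω ^ (1 + p / q - p) * G := by gcongr
      _ = _ := by rw [NNReal.mul_rpow, hY]; ring
  refine supTV_le fun c hc => truncVar_le_iff.2 fun n x hx hxI => ?_
  have hc2 : 0 < c / 2 := by positivity
  set J : ℕ → ℝ≥0∞ :=
    fun i => ‖I (x (i + 1)) - I (x i) - f (x i) (g (x (i + 1)) - g (x i))‖ₑ with hJ
  have hJΦ : ∀ i, J i ≤ 8 * youngGauge ρ σ ω θ f g (x i) (x (i + 1)) := fun i =>
    enorm_increment_le hρ1 hσ1 (hxI i).1 (hx i.le_succ) (hI _ (hxI i)) (hI _ (hxI (i + 1)))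
      fun s hs t ht => hω s ⟨(hxI i).1.trans hs.1, hs.2.trans (hxI (i + 1)).2⟩ t
        ⟨(hxI i).1.trans ht.1, ht.2.trans (hxI (i + 1)).2⟩
  have hJX : ∀ i, J i ≤ X := fun i => (hJΦ i).trans (le_trans
    (by gcongr; exact youngGauge_mono (hxI i).1 (hxI (i + 1)).2) hΦX)
  have hJsum : ∑ i ∈ Finset.range n, J i ≤ X := by
    refine (Finset.sum_le_sum fun i _ => hJΦ i).trans ?_
    rw [← Finset.mul_sum]
    refine le_trans ?_ hΦX
    gcongr
    exact (sum_le_of_superadditive (T := youngGauge ρ σ ω θ f g) youngGauge_add_le n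
      fun i _ => hx i.le_succ).trans (youngGauge_mono (hxI 0).1 (hxI n).2)
  -- The truncation c is shared equally between the error and the main term; taking ω out of the
  -- latter changes its level to c/(2ω).
  have hstep : ∀ i, ‖I (x (i + 1)) - I (x i)‖ₑ - c ≤
      (J i - (c / 2 : ℝ≥0)) + ω * (‖g (x (i + 1)) - g (x i)‖ₑ - (c / 2 / ω : ℝ≥0)) := by
    intro i
    have hfx : ‖f (x i)‖ₑ ≤ ω := by
      have := hω (x i) (hxI i) a ⟨le_rfl, (hxI 0).1.trans (hxI 0).2⟩
      rwa [hfa, sub_zero] at this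
    have hle : ‖I (x (i + 1)) - I (x i)‖ₑ ≤ J i + ω * ‖g (x (i + 1)) - g (x i)‖ₑ := by
      calc ‖I (x (i + 1)) - I (x i)‖ₑ =
            ‖(I (x (i + 1)) - I (x i) - f (x i) (g (x (i + 1)) - g (x i))) +
              f (x i) (g (x (i + 1)) - g (x i))‖ₑ := by rw [sub_add_cancel]
        _ ≤ _ := (enorm_add_le _ _).trans (add_le_add le_rfl
            ((ContinuousLinearMap.le_opENorm _ _).trans (by gcongr)))
    have hωc : (ω : ℝ≥0∞) * ((c / 2 / ω : ℝ≥0) : ℝ≥0∞) = ((c / 2 : ℝ≥0) : ℝ≥0∞) := by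
      rw [← ENNReal.coe_mul, mul_div_cancel₀ _ hω0.ne']
    rw [ENNReal.mul_sub fun _ _ => ENNReal.coe_ne_top, hωc]
    rw [tsub_le_iff_right]
    refine hle.trans ?_
    calc _ ≤ (J i - (c / 2 : ℝ≥0) + (c / 2 : ℝ≥0)) +
          (ω * ‖g (x (i + 1)) - g (x i)‖ₑ - (c / 2 : ℝ≥0) + (c / 2 : ℝ≥0)) :=
          add_le_add le_tsub_add le_tsub_add
      _ = (J i - (c / 2 : ℝ≥0)) + (ω * ‖g (x (i + 1)) - g (x i)‖ₑ - (c / 2 : ℝ≥0)) +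
          ((c / 2 : ℝ≥0) + (c / 2 : ℝ≥0)) := by ring
      _ = _ := by rw [← ENNReal.coe_add, add_halves]
  have hsum1 : ∑ i ∈ Finset.range n, (J i - (c / 2 : ℝ≥0)) ≤
      (((c / 2) ^ (1 - q) * X ^ q : ℝ≥0) : ℝ≥0∞) := by
    calc _ ≤ ∑ i ∈ Finset.range n, (((c / 2) ^ (1 - q) * X ^ (q - 1) : ℝ≥0) : ℝ≥0∞) * J i :=
          Finset.sum_le_sum fun i _ => tsub_le_rpow_mul hq hc2 (hJX i)
      _ ≤ (((c / 2) ^ (1 - q) * X ^ (q - 1) : ℝ≥0) : ℝ≥0∞) * X := by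
          rw [← Finset.mul_sum]
          gcongr
      _ = _ := by
          rw [← ENNReal.coe_mul, mul_assoc, ← NNReal.rpow_add_one' (by linarith), sub_add_cancel]
  have hsum2 : ∑ i ∈ Finset.range n, (ω : ℝ≥0∞) *
      (‖g (x (i + 1)) - g (x i)‖ₑ - (c / 2 / ω : ℝ≥0)) ≤
      (((c / 2) ^ (1 - q) * (ω * G) ^ q : ℝ≥0) : ℝ≥0∞) := by
    rw [← Finset.mul_sum]
    have h := (sum_le_truncVar (f := g) (c / 2 / ω) n hx hxI).trans
      ((truncVar_le_supTV q (show 0 < c / 2 / ω by positivity)).trans (mul_le_mul_right hG _))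
    refine (mul_le_mul_right h _).trans (le_of_eq ?_)
    rw [← ENNReal.coe_mul, ← ENNReal.coe_mul, NNReal.mul_rpow, NNReal.div_rpow _ ω]
    congr 1
    have hωq : ω / ω ^ (1 - q) = ω ^ q := by
      nth_rewrite 1 [← NNReal.rpow_one ω]
      rw [← NNReal.rpow_sub hω0.ne', sub_sub_cancel]
    rw [← hωq]
    ring
  calc _ ≤ ∑ i ∈ Finset.range n, ((J i - (c / 2 : ℝ≥0)) +
        ω * (‖g (x (i + 1)) - g (x i)‖ₑ - (c / 2 / ω : ℝ≥0))) :=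
        Finset.sum_le_sum fun i _ => hstep i
    _ ≤ (((c / 2) ^ (1 - q) * X ^ q : ℝ≥0) : ℝ≥0∞) +
        (((c / 2) ^ (1 - q) * (ω * G) ^ q : ℝ≥0) : ℝ≥0∞) := by
        rw [Finset.sum_add_distrib]
        exact add_le_add hsum1 hsum2
    _ ≤ _ := by
        rw [← ENNReal.coe_add, ← ENNReal.coe_mul, ENNReal.coe_le_coe]
        set Z : ℝ≥0 := (16 * gaugeConst ρ σ p q + 2 ^ (p - p / q)) * Y with hZ
        have hXZ : X ≤ Z := by rw [hX, hZ]; gcongr; exact le_self_add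
        have hGZ : ω * G ≤ Z := hωG.trans (by rw [hZ]; gcongr; exact le_add_self)
        calc _ ≤ (c / 2) ^ (1 - q) * Z ^ q + (c / 2) ^ (1 - q) * Z ^ q := by gcongr
          -- Here 2 / 2^(1-q) = 2^q, which is the outer factor 2 of `integralConst` raised to the
          -- power q.
          _ = c ^ (1 - q) * ((2 / 2 ^ (1 - q)) * Z ^ q) := by
            rw [NNReal.div_rpow]
            ring
          _ = _ := by
            rw [show integralConst ρ σ p q * Y = 2 * Z by rw [hZ, integralConst]; ring,
              NNReal.mul_rpow (x := 2) (y := Z)]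
            congr 2
            nth_rewrite 1 [← NNReal.rpow_one 2]
            rw [← NNReal.rpow_sub two_ne_zero, sub_sub_cancel]

end MainEstimate

/-! ### Invariance under constants, and passage to the seminorms. -/

section Invariance

variable {W : Type*} [SeminormedAddCommGroup W]

theorem truncVar_sub_const (f : ℝ → W) (w : W) (a b : ℝ) (c : ℝ≥0) :
    truncVar (fun s => f s - w) a b c = truncVar f a b c := by
  simp only [truncVar, sub_sub_sub_cancel_right]

theorem supTV_sub_const (p : ℝ) (f : ℝ → W) (w : W) (a b : ℝ) :
    supTV p (fun s => f s - w) a b = supTV p f a b := by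
  simp only [supTV, truncVar_sub_const]

theorem supTV_mono (p : ℝ) (f : ℝ → W) {a b t : ℝ} (ht : t ≤ b) :
    supTV p f a t ≤ supTV p f a b :=
  iSup₂_mono fun _ _ => by gcongr; exact truncVar_mono le_rfl ht _

theorem enorm_sub_le_oscSeminorm (f : ℝ → W) {a b x y : ℝ} (hx : x ∈ Set.Icc a b)
    (hy : y ∈ Set.Icc a b) : ‖f x - f y‖ₑ ≤ oscSeminorm f a b := by
  have key : ∀ s t, a ≤ s ∧ s < t ∧ t ≤ b → ‖f s - f t‖ₑ ≤ oscSeminorm f a b := by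
    intro s t h
    rw [← ofReal_norm]
    exact le_iSup_of_le s (le_iSup_of_le t (le_iSup_of_le h le_rfl))
  rcases lt_trichotomy x y with h | rfl | h
  · exact key x y ⟨hx.1, h, hy.2⟩
  · simp [enorm_eq_nnnorm]
  · rw [← ofReal_norm, norm_sub_rev, ofReal_norm]
    exact key y x ⟨hy.1, h, hx.2⟩

theorem coe_pTVSeminorm_toNNReal_rpow {p : ℝ} (hp : 0 < p) {f : ℝ → W} {a b : ℝ}
    (hf : MemU p f a b) :
    (((pTVSeminorm p f a b).toNNReal ^ p : ℝ≥0) : ℝ≥0∞) = supTV p f a b := by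
  have hne : pTVSeminorm p f a b ≠ ∞ := ENNReal.rpow_ne_top_of_nonneg (by positivity) hf.ne
  rw [ENNReal.coe_rpow_of_nonneg _ hp.le, ENNReal.coe_toNNReal hne, pTVSeminorm,
    ← ENNReal.rpow_mul, one_div_mul_cancel hp.ne', ENNReal.rpow_one]

theorem oscSeminorm_le {p : ℝ} (hp : 0 < p) {f : ℝ → W} {a b : ℝ} {F : ℝ≥0}
    (hF : supTV p f a b ≤ (F ^ p : ℝ≥0)) : oscSeminorm f a b ≤ ((2 * F : ℝ≥0) : ℝ≥0∞) := by
  refine iSup_le fun s => iSup_le fun t => iSup_le fun h => ?_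
  rw [norm_sub_rev, ofReal_norm]
  exact enorm_sub_le_of_supTV_le hp hF h.1 h.2.1.le h.2.2

end Invariance

/-! ### The theorem. -/

theorem theorem3 (p q : ℝ) (hp : 1 < p) (hq : 1 < q) (hpq : 1 < p⁻¹ + q⁻¹) :
    ∃ D : ℝ≥0, ∀ (𝕜 : Type*) (E : Type*) (V : Type*) [RCLike 𝕜]
      [NormedAddCommGroup E] [NormedSpace 𝕜 E] [CompleteSpace E]
      [NormedAddCommGroup V] [NormedSpace 𝕜 V] [CompleteSpace V]
      (a b : ℝ) (f : ℝ → E →L[𝕜] V) (g : ℝ → E),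
      a < b → MemU p f a b → MemU q g a b → NoCommonDiscontinuity f g a b →
      ∃ I : ℝ → V,
        (∀ t ∈ Set.Icc a b, HasRSIntegral (fun s => f s - f a) g a t (I t)) ∧
        MemU q I a b ∧
        pTVSeminorm q I a b ≤
          (D : ℝ≥0∞) * pTVSeminorm p f a b ^ (p - p / q) *
            oscSeminorm f a b ^ (1 + p / q - p) * pTVSeminorm q g a b := by
  obtain ⟨ρ, σ, hρ, hρ1, hσ, hσ1, h1, h2⟩ := exists_ratios hp hq hpq
  refine ⟨integralConst ρ σ p q, ?_⟩
  intro 𝕜 E V _ _ _ _ _ _ _ a b f g hab hf hg hfg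
  have hp0 : 0 < p := by linarith
  have hq0 : 0 < q := by linarith
  have hα : 0 ≤ p - p / q := sub_nonneg.2 (div_le_self hp0.le hq.le)
  have hβ : 0 ≤ 1 + p / q - p := by
    have h : p * (p⁻¹ + q⁻¹) = 1 + p / q := by field_simp
    nlinarith
  set h : ℝ → E →L[𝕜] V := fun s => f s - f a with hh
  have hexists : ∀ t ∈ Set.Icc a b, ∃ v, HasRSIntegral h g a t v := by
    intro t ht
    refine exists_hasRSIntegral ht.1 hρ1 hσ1 ?_ fun ε hε =>
      exists_youngGauge_lt (p := p) (q := q) hρ hσ h1 h2 ?_ ?_ hε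
    · intro s hs
      have hsub : Set.Icc a t ⊆ Set.Icc a b := Set.Icc_subset_Icc_right ht.2
      exact (hfg s (hsub hs)).imp (fun hc => (hc.mono hsub).sub continuousWithinAt_const)
        fun hc => hc.mono hsub
    · rw [MemU, hh, supTV_sub_const]
      exact (supTV_mono p f ht.2).trans_lt hf
    · exact (supTV_mono q g ht.2).trans_lt hg
  -- Outside [a,b] the values of I are arbitrary; no functional on [a,b] sees them.
  choose! I hI using hexists
  set F₀ := (pTVSeminorm p f a b).toNNReal with hF₀
  set G₀ := (pTVSeminorm q g a b).toNNReal with hG₀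
  set ω₀ := (oscSeminorm f a b).toNNReal with hω₀
  have hF := coe_pTVSeminorm_toNNReal_rpow hp0 hf
  have hG := coe_pTVSeminorm_toNNReal_rpow hq0 hg
  have hosc := oscSeminorm_le hp0 hF.ge
  have hosc_ne : oscSeminorm f a b ≠ ∞ := ne_top_of_le_ne_top ENNReal.coe_ne_top hosc
  have hωF : ω₀ ≤ 2 * F₀ := by
    rw [← ENNReal.coe_le_coe, hω₀, ENNReal.coe_toNNReal hosc_ne]
    exact hosc
  -- The estimate needs F, G, ω > 0, while the seminorms may vanish. They are enlarged by ε, and ε →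
  -- 0 is harmless because the exponents are nonnegative.
  have hεbound : ∀ ε : ℝ≥0, 0 < ε → supTV q I a b ≤ (((integralConst ρ σ p q *
      ((F₀ + ε) ^ (p - p / q) * (ω₀ + ε) ^ (1 + p / q - p) * (G₀ + ε))) ^ q : ℝ≥0) : ℝ≥0∞) := by
    intro ε hε
    refine supTV_integral_le (f := h) (g := g) hp hq hρ hρ1 hσ hσ1 h1 h2 (by positivity)
      (by positivity) (by positivity) ?_ ?_ ?_ ?_ (sub_self _) hI
    · rw [hh, supTV_sub_const, ← hF, ENNReal.coe_le_coe]
      gcongr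
      exact le_self_add
    · rw [← hG, ENNReal.coe_le_coe]
      gcongr
      exact le_self_add
    · intro x hx y hy
      simp only [hh, sub_sub_sub_cancel_right]
      refine (enorm_sub_le_oscSeminorm f hx hy).trans ?_
      rw [← ENNReal.coe_toNNReal hosc_ne, ENNReal.coe_le_coe]
      exact le_self_add
    · calc ω₀ + ε ≤ 2 * F₀ + 2 * ε := add_le_add hωF (le_mul_of_one_le_left zero_le one_le_two)
        _ = _ := by ring
  have hbound : supTV q I a b ≤ (((integralConst ρ σ p q *
      (F₀ ^ (p - p / q) * ω₀ ^ (1 + p / q - p) * G₀)) ^ q : ℝ≥0) : ℝ≥0∞) := by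
    have hcont : Continuous fun ε : ℝ≥0 => (integralConst ρ σ p q *
        ((F₀ + ε) ^ (p - p / q) * (ω₀ + ε) ^ (1 + p / q - p) * (G₀ + ε))) ^ q := by
      have := NNReal.continuous_rpow_const hα
      have := NNReal.continuous_rpow_const hβ
      have := NNReal.continuous_rpow_const hq0.le
      fun_prop
    have hlim := ((ENNReal.continuous_coe.comp hcont).tendsto 0).mono_left
      (nhdsWithin_le_nhds (s := Set.Ioi 0))
    simp only [Function.comp_def, add_zero] at hlim
    refine ge_of_tendsto hlim ?_
    filter_upwards [self_mem_nhdsWithin] with ε hε using hεbound ε hε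
  refine ⟨I, hI, hbound.trans_lt ENNReal.coe_lt_top, ?_⟩
  have hFne : pTVSeminorm p f a b ≠ ∞ := ENNReal.rpow_ne_top_of_nonneg (by positivity) hf.ne
  have hGne : pTVSeminorm q g a b ≠ ∞ := ENNReal.rpow_ne_top_of_nonneg (by positivity) hg.ne
  calc pTVSeminorm q I a b ≤ (((integralConst ρ σ p q *
        (F₀ ^ (p - p / q) * ω₀ ^ (1 + p / q - p) * G₀)) ^ q : ℝ≥0) : ℝ≥0∞) ^ (1 / q) :=
        ENNReal.rpow_le_rpow hbound (by positivity)
    _ = ((integralConst ρ σ p q *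
        (F₀ ^ (p - p / q) * ω₀ ^ (1 + p / q - p) * G₀) : ℝ≥0) : ℝ≥0∞) := by
        rw [ENNReal.coe_rpow_of_nonneg _ hq0.le, ← ENNReal.rpow_mul, mul_one_div_cancel hq0.ne',
          ENNReal.rpow_one]
    _ = _ := by
        rw [← ENNReal.coe_toNNReal hFne, ← ENNReal.coe_toNNReal hGne,
          ← ENNReal.coe_toNNReal hosc_ne, ← hF₀, ← hG₀, ← hω₀,
          ← ENNReal.coe_rpow_of_nonneg _ hα, ← ENNReal.coe_rpow_of_nonneg _ hβ]
        push_cast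
        ring
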